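/- An oriented singquandle is a set $X$ with a quandle operation $*$ (so $x*x=x$, each map $z\mapsto z*y$ is a bijection with inverse $x\mapsto x\,\bar*\,y$, and $(x*y)*z=(x*z)*(y*z)$) and two further binary operations $\circ_l,\circ_r$ such that for all $x,y,z\in X$ and for $\circ\in\{\circ_l,\circ_r\}$ $$(x\circ y)*z=(x*z)\circ(y*z),\quad (x\circ y)\,\bar*\,z=(x\,\bar*\,z)\circ(y\,\bar*\,z),\quad (y\,\bar*\,(x\circ_l z))*x=(y*(x\circ_r z))\,\bar*\,z,$$ $$x\circ_r y=y\circ_l(x*y),\qquad (x\circ_l y)*(x\circ_r y)=y\circ_r(x*y).$$ Oriented singular links are considered as oriented singular link diagrams in the plane up to planar isotopy and singular Reidemeister moves. The fundamental oriented singquandle $SQ(D)$ of a diagram $D$ is the oriented singquandle whose generators are the arcs of $D$ (the components left after cutting $D$ at the singular crossings and cutting the lower strand at each classical crossing), with the following relations. At a classical crossing whose upper arc is $y$, if $x$ and $z$ are the lower arcs to the right and to the left of $y$ (with respect to the direction of $y$), then $z=x*y$. At a singular crossing, turned so that both strands run downward, if $x,y$ are the arcs at the top left and at the top right, then the arcs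 at the bottom left and at the bottom right are equal to $x\circ_l y$ and $x\circ_r y$ respectively. For an oriented singular link $L$, $SQ(L)$ denotes $SQ(D)$ for any diagram $D$ of $L$; up to isomorphism it does not depend on $D$. Let $SB_n$ be the singular braid monoid on $n$ strands, generated by $\sigma_i,\sigma_i^{-1},\tau_i$ ($1\le i\le n-1$) subject to $\sigma_i\sigma_i^{-1}=\sigma_i^{-1}\sigma_i=1$; $\sigma_i\sigma_{i+1}\sigma_i=\sigma_{i+1}\sigma_i\sigma_{i+1}$; $\sigma_i\sigma_j=\sigma_j\sigma_i$, $\tau_i\tau_j=\tau_j\tau_i$, $\tau_i\sigma_j=\sigma_j\tau_i$ for $|i-j|\ge2$; $\tau_i\sigma_i=\sigma_i\tau_i$; $\sigma_i\sigma_{i+1}\tau_i=\tau_{i+1}\sigma_i\sigma_{i+1}$; $\sigma_{i+1}\sigma_i\tau_{i+1}=\tau_i\sigma_{i+1}\sigma_i$. Braid words are drawn from top to bottom with all strands running downward; in $\sigma_i$ the strand from position $i+1$ at the top to position $i$ at the bottom passes over the strand from $i$ to $i+1$, in $\sigma_i^{-1}$ the strand from $i$ to $i+1$ passes over, and $\tau_i$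 is the singular crossing of these strands. Let $FSQ_n$ be the free oriented singquandle on $x_1,\dots,x_n$, and let $\Phi:SB_n\to\operatorname{End}(FSQ_n)$ be the monoid homomorphism (where the product in $\operatorname{End}(FSQ_n)$ is composition of maps, so $\Phi(\alpha\beta)(x)=\Phi(\alpha)(\Phi(\beta)(x))$) given by $$\Phi(\sigma_i):\ x_i\mapsto x_{i+1},\quad x_{i+1}\mapsto x_i*x_{i+1},\qquad \Phi(\tau_i):\ x_i\mapsto x_i\circ_l x_{i+1},\quad x_{i+1}\mapsto x_i\circ_r x_{i+1},$$ with $x_j\mapsto x_j$ for $j\ne i,i+1$ in both cases, and $\Phi(\sigma_i^{-1})=\Phi(\sigma_i)^{-1}$. **Theorem.** If the oriented singular link $L$ is the closure of the singular braid $\beta\in SB_n$, then $$SQ(L)\cong\langle x_1,\dots,x_n\mid x_i=\Phi(\beta)(x_i),\ i=1,\dots,n\rangle .$$ That is, for every diagram $D$ of $L$, the oriented singquandle $SQ(D)$ is isomorphic to the oriented singquandle with generators $x_1,\dots,x_n$ and these $n$ relations. -/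

import Mathlib

/-! ## Oriented singquandles -/

/-- The quandle operation in the right-handed convention: `x ⋆ y` is `y` acting on `x`. -/
notation:70 x:70 " ⋆ " y:71 => Shelf.act y x

/-- The inverse quandle operation: `x ⋆⁻ y` is the unique `z` with `z ⋆ y = x`. -/
notation:70 x:70 " ⋆⁻ " y:71 => Rack.invAct y x

/-- An oriented singquandle: a quandle `(X, ⋆)` with two further binary operations
`opl` (written `∘_l` on paper) and `opr` (written `∘_r`). -/
class Singquandle (X : Type*) extends Quandle X where
  opl : X → X → X
  opr : X → X → X
  opl_star : ∀ x y z : X, opl x y ⋆ z = opl (x ⋆ z) (y ⋆ z)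
  opr_star : ∀ x y z : X, opr x y ⋆ z = opr (x ⋆ z) (y ⋆ z)
  opl_bar : ∀ x y z : X, opl x y ⋆⁻ z = opl (x ⋆⁻ z) (y ⋆⁻ z)
  opr_bar : ∀ x y z : X, opr x y ⋆⁻ z = opr (x ⋆⁻ z) (y ⋆⁻ z)
  bar_star : ∀ x y z : X, (y ⋆⁻ opl x z) ⋆ x = (y ⋆ opr x z) ⋆⁻ z
  opr_eq : ∀ x y : X, opr x y = opl y (x ⋆ y)
  opl_star_opr : ∀ x y : X, opl x y ⋆ opr x y = opr y (x ⋆ y)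

/-- Homomorphisms of singquandles. -/
@[ext]
structure SQHom (X Y : Type*) [Singquandle X] [Singquandle Y] where
  toFun : X → Y
  map_star : ∀ x y, toFun (x ⋆ y) = toFun x ⋆ toFun y
  map_opl : ∀ x y, toFun (Singquandle.opl x y) = Singquandle.opl (toFun x) (toFun y)
  map_opr : ∀ x y, toFun (Singquandle.opr x y) = Singquandle.opr (toFun x) (toFun y)

/-- Isomorphisms of singquandles. -/
structure SQEquiv (X Y : Type*) [Singquandle X] [Singquandle Y] extends X ≃ Y where
  map_star : ∀ x y, toFun (x ⋆ y) = toFun x ⋆ toFun y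
  map_opl : ∀ x y, toFun (Singquandle.opl x y) = Singquandle.opl (toFun x) (toFun y)
  map_opr : ∀ x y, toFun (Singquandle.opr x y) = Singquandle.opr (toFun x) (toFun y)

namespace SQHom

variable {X Y : Type*} [Singquandle X] [Singquandle Y]

theorem map_bar (f : SQHom X Y) (x y : X) : f.toFun (x ⋆⁻ y) = f.toFun x ⋆⁻ f.toFun y := by
  have h : f.toFun ((x ⋆⁻ y) ⋆ y) = f.toFun x := by rw [Rack.right_inv y x]
  rw [← h, f.map_star, Rack.left_inv]

/-- The monoid `End(X)`; the product `f * g` is the composition `x ↦ f (g x)`. -/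
instance : Monoid (SQHom X X) where
  mul f g :=
    { toFun := fun x => f.toFun (g.toFun x)
      map_star := fun x y => by rw [g.map_star, f.map_star]
      map_opl := fun x y => by rw [g.map_opl, f.map_opl]
      map_opr := fun x y => by rw [g.map_opr, f.map_opr] }
  one :=
    { toFun := fun x => x
      map_star := fun _ _ => rfl
      map_opl := fun _ _ => rfl
      map_opr := fun _ _ => rfl }
  mul_assoc _ _ _ := rfl
  one_mul _ := rfl
  mul_one _ := rfl

theorem mul_toFun (f g : SQHom X X) (x : X) : (f * g).toFun x = f.toFun (g.toFun x) := rfl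

theorem one_toFun (x : X) : (1 : SQHom X X).toFun x = x := rfl

end SQHom

/-! ## Free singquandles -/

/-- Formal terms in the singquandle operations over a set of variables. -/
inductive SQTerm (α : Type*) : Type _
  | var : α → SQTerm α
  | star : SQTerm α → SQTerm α → SQTerm α
  | bar : SQTerm α → SQTerm α → SQTerm α
  | opl : SQTerm α → SQTerm α → SQTerm α
  | opr : SQTerm α → SQTerm α → SQTerm α

/-- Equality of terms as a consequence of the singquandle axioms. -/
inductive SQTerm.Eqv {α : Type*} : SQTerm α → SQTerm α → Prop
  | refl (x) : Eqv x x
  | symm {x y} : Eqv x y → Eqv y x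
  | trans {x y z} : Eqv x y → Eqv y z → Eqv x z
  | star_congr {x x' y y'} : Eqv x x' → Eqv y y' → Eqv (star x y) (star x' y')
  | bar_congr {x x' y y'} : Eqv x x' → Eqv y y' → Eqv (bar x y) (bar x' y')
  | opl_congr {x x' y y'} : Eqv x x' → Eqv y y' → Eqv (opl x y) (opl x' y')
  | opr_congr {x x' y y'} : Eqv x x' → Eqv y y' → Eqv (opr x y) (opr x' y')
  | idem (x) : Eqv (star x x) x
  | star_bar_cancel (x y) : Eqv (bar (star x y) y) x
  | bar_star_cancel (x y) : Eqv (star (bar x y) y) x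
  | distrib (x y z) : Eqv (star (star x y) z) (star (star x z) (star y z))
  | opl_star (x y z) : Eqv (star (opl x y) z) (opl (star x z) (star y z))
  | opr_star (x y z) : Eqv (star (opr x y) z) (opr (star x z) (star y z))
  | opl_bar (x y z) : Eqv (bar (opl x y) z) (opl (bar x z) (bar y z))
  | opr_bar (x y z) : Eqv (bar (opr x y) z) (opr (bar x z) (bar y z))
  | bar_star (x y z) : Eqv (star (bar y (opl x z)) x) (bar (star y (opr x z)) z)
  | opr_eq (x y) : Eqv (opr x y) (opl y (star x y))
  | opl_star_opr (x y) : Eqv (star (opl x y) (opr x y)) (opr y (star x y))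

def SQTerm.setoid (α : Type*) : Setoid (SQTerm α) where
  r := SQTerm.Eqv
  iseqv := ⟨.refl, .symm, .trans⟩

/-- The free oriented singquandle on the set `α`. -/
def FreeSQ (α : Type*) : Type _ := Quotient (SQTerm.setoid α)

namespace FreeSQ

variable {α : Type*}

/-- The free generators. -/
def of (a : α) : FreeSQ α := Quotient.mk (SQTerm.setoid α) (.var a)

instance : Singquandle (FreeSQ α) where
  act y x := Quotient.map₂ SQTerm.star (fun _ _ h _ _ h' => .star_congr h h') x y
  invAct y x := Quotient.map₂ SQTerm.bar (fun _ _ h _ _ h' => .bar_congr h h') x y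
  opl := Quotient.map₂ SQTerm.opl (fun _ _ h _ _ h' => .opl_congr h h')
  opr := Quotient.map₂ SQTerm.opr (fun _ _ h _ _ h' => .opr_congr h h')
  self_distrib {x y z} := by
    induction x using Quotient.inductionOn
    induction y using Quotient.inductionOn
    induction z using Quotient.inductionOn
    exact Quotient.sound (.distrib _ _ _)
  left_inv y x := by
    induction x using Quotient.inductionOn
    induction y using Quotient.inductionOn
    exact Quotient.sound (.star_bar_cancel _ _)
  right_inv y x := by
    induction x using Quotient.inductionOn
    induction y using Quotient.inductionOn
    exact Quotient.sound (.bar_star_cancel _ _)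
  fix {x} := by
    induction x using Quotient.inductionOn
    exact Quotient.sound (.idem _)
  opl_star x y z := by
    induction x using Quotient.inductionOn
    induction y using Quotient.inductionOn
    induction z using Quotient.inductionOn
    exact Quotient.sound (.opl_star _ _ _)
  opr_star x y z := by
    induction x using Quotient.inductionOn
    induction y using Quotient.inductionOn
    induction z using Quotient.inductionOn
    exact Quotient.sound (.opr_star _ _ _)
  opl_bar x y z := by
    induction x using Quotient.inductionOn
    induction y using Quotient.inductionOn
    induction z using Quotient.inductionOn
    exact Quotient.sound (.opl_bar _ _ _)
  opr_bar x y z := by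
    induction x using Quotient.inductionOn
    induction y using Quotient.inductionOn
    induction z using Quotient.inductionOn
    exact Quotient.sound (.opr_bar _ _ _)
  bar_star x y z := by
    induction x using Quotient.inductionOn
    induction y using Quotient.inductionOn
    induction z using Quotient.inductionOn
    exact Quotient.sound (.bar_star _ _ _)
  opr_eq x y := by
    induction x using Quotient.inductionOn
    induction y using Quotient.inductionOn
    exact Quotient.sound (.opr_eq _ _)
  opl_star_opr x y := by
    induction x using Quotient.inductionOn
    induction y using Quotient.inductionOn
    exact Quotient.sound (.opl_star_opr _ _)

/-- Evaluation of a term in a singquandle. -/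
def eval {X : Type*} [Singquandle X] (c : α → X) : SQTerm α → X
  | .var a => c a
  | .star s t => eval c s ⋆ eval c t
  | .bar s t => eval c s ⋆⁻ eval c t
  | .opl s t => Singquandle.opl (eval c s) (eval c t)
  | .opr s t => Singquandle.opr (eval c s) (eval c t)

theorem eval_eqv {X : Type*} [Singquandle X] (c : α → X) {s t : SQTerm α}
    (h : SQTerm.Eqv s t) : eval c s = eval c t := by
  induction h with
  | refl => rfl
  | symm _ ih => exact ih.symm
  | trans _ _ ih1 ih2 => exact ih1.trans ih2
  | star_congr _ _ ih1 ih2 => simp only [eval, ih1, ih2]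
  | bar_congr _ _ ih1 ih2 => simp only [eval, ih1, ih2]
  | opl_congr _ _ ih1 ih2 => simp only [eval, ih1, ih2]
  | opr_congr _ _ ih1 ih2 => simp only [eval, ih1, ih2]
  | idem => exact Quandle.fix
  | star_bar_cancel x y => exact Rack.left_inv _ _
  | bar_star_cancel x y => exact Rack.right_inv _ _
  | distrib => exact Shelf.self_distrib
  | opl_star => exact Singquandle.opl_star _ _ _
  | opr_star => exact Singquandle.opr_star _ _ _
  | opl_bar => exact Singquandle.opl_bar _ _ _
  | opr_bar => exact Singquandle.opr_bar _ _ _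
  | bar_star => exact Singquandle.bar_star _ _ _
  | opr_eq => exact Singquandle.opr_eq _ _
  | opl_star_opr => exact Singquandle.opl_star_opr _ _

/-- The homomorphism from the free singquandle with prescribed values on the generators. -/
def lift {X : Type*} [Singquandle X] (c : α → X) : SQHom (FreeSQ α) X where
  toFun := Quotient.lift (eval c) (fun _ _ h => eval_eqv c h)
  map_star x y := by
    induction x using Quotient.inductionOn
    induction y using Quotient.inductionOn
    rfl
  map_opl x y := by
    induction x using Quotient.inductionOn
    induction y using Quotient.inductionOn
    rfl
  map_opr x y := by
    induction x using Quotient.inductionOn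
    induction y using Quotient.inductionOn
    rfl

theorem lift_of {X : Type*} [Singquandle X] (c : α → X) (a : α) :
    (lift c).toFun (of a) = c a := rfl

theorem hom_ext {X : Type*} [Singquandle X] {f g : SQHom (FreeSQ α) X}
    (h : ∀ a, f.toFun (of a) = g.toFun (of a)) : f = g := by
  ext x
  induction x using Quotient.inductionOn with
  | h t =>
    induction t with
    | var a => exact h a
    | star s t hs ht =>
      exact (f.map_star _ _).trans ((congrArg₂ (fun x y => x ⋆ y) hs ht).trans
        (g.map_star _ _).symm)
    | bar s t hs ht =>
      exact (f.map_bar _ _).trans ((congrArg₂ (fun x y => x ⋆⁻ y) hs ht).trans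
        (g.map_bar _ _).symm)
    | opl s t hs ht =>
      exact (f.map_opl _ _).trans ((congrArg₂ Singquandle.opl hs ht).trans (g.map_opl _ _).symm)
    | opr s t hs ht =>
      exact (f.map_opr _ _).trans ((congrArg₂ Singquandle.opr hs ht).trans (g.map_opr _ _).symm)

end FreeSQ

/-! ## Singquandles given by generators and relations -/

/-- The congruence of the singquandle `Q` generated by the relation `r`. -/
inductive SQCon {Q : Type*} [Singquandle Q] (r : Q → Q → Prop) : Q → Q → Prop
  | of {x y} : r x y → SQCon r x y
  | refl (x) : SQCon r x x
  | symm {x y} : SQCon r x y → SQCon r y x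
  | trans {x y z} : SQCon r x y → SQCon r y z → SQCon r x z
  | star {x x' y y'} : SQCon r x x' → SQCon r y y' → SQCon r (x ⋆ y) (x' ⋆ y')
  | bar {x x' y y'} : SQCon r x x' → SQCon r y y' → SQCon r (x ⋆⁻ y) (x' ⋆⁻ y')
  | opl {x x' y y'} : SQCon r x x' → SQCon r y y' →
      SQCon r (Singquandle.opl x y) (Singquandle.opl x' y')
  | opr {x x' y y'} : SQCon r x x' → SQCon r y y' →
      SQCon r (Singquandle.opr x y) (Singquandle.opr x' y')

def SQCon.setoid {Q : Type*} [Singquandle Q] (r : Q → Q → Prop) : Setoid Q where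
  r := SQCon r
  iseqv := ⟨.refl, .symm, .trans⟩

/-- The singquandle `⟨ α | r ⟩` with generators `α` and relations `u = v` for `r u v`,
where `u` and `v` are elements of the free singquandle on `α`. -/
def PresentedSQ {α : Type*} (r : FreeSQ α → FreeSQ α → Prop) : Type _ :=
  Quotient (SQCon.setoid r)

namespace PresentedSQ

variable {α : Type*} (r : FreeSQ α → FreeSQ α → Prop)

instance : Singquandle (PresentedSQ r) where
  act y x := Quotient.map₂ (fun x y => x ⋆ y) (fun _ _ h _ _ h' => .star h h') x y
  invAct y x := Quotient.map₂ (fun x y => x ⋆⁻ y) (fun _ _ h _ _ h' => .bar h h') x y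
  opl := Quotient.map₂ Singquandle.opl (fun _ _ h _ _ h' => .opl h h')
  opr := Quotient.map₂ Singquandle.opr (fun _ _ h _ _ h' => .opr h h')
  self_distrib {x y z} := by
    induction x using Quotient.inductionOn
    induction y using Quotient.inductionOn
    induction z using Quotient.inductionOn
    exact congrArg (Quotient.mk _) Shelf.self_distrib
  left_inv y x := by
    induction x using Quotient.inductionOn
    induction y using Quotient.inductionOn
    exact congrArg (Quotient.mk _) (Rack.left_inv _ _)
  right_inv y x := by
    induction x using Quotient.inductionOn
    induction y using Quotient.inductionOn
    exact congrArg (Quotient.mk _) (Rack.right_inv _ _)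
  fix {x} := by
    induction x using Quotient.inductionOn
    exact congrArg (Quotient.mk _) Quandle.fix
  opl_star x y z := by
    induction x using Quotient.inductionOn
    induction y using Quotient.inductionOn
    induction z using Quotient.inductionOn
    exact congrArg (Quotient.mk _) (Singquandle.opl_star _ _ _)
  opr_star x y z := by
    induction x using Quotient.inductionOn
    induction y using Quotient.inductionOn
    induction z using Quotient.inductionOn
    exact congrArg (Quotient.mk _) (Singquandle.opr_star _ _ _)
  opl_bar x y z := by
    induction x using Quotient.inductionOn
    induction y using Quotient.inductionOn
    induction z using Quotient.inductionOn
    exact congrArg (Quotient.mk _) (Singquandle.opl_bar _ _ _)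
  opr_bar x y z := by
    induction x using Quotient.inductionOn
    induction y using Quotient.inductionOn
    induction z using Quotient.inductionOn
    exact congrArg (Quotient.mk _) (Singquandle.opr_bar _ _ _)
  bar_star x y z := by
    induction x using Quotient.inductionOn
    induction y using Quotient.inductionOn
    induction z using Quotient.inductionOn
    exact congrArg (Quotient.mk _) (Singquandle.bar_star _ _ _)
  opr_eq x y := by
    induction x using Quotient.inductionOn
    induction y using Quotient.inductionOn
    exact congrArg (Quotient.mk _) (Singquandle.opr_eq _ _)
  opl_star_opr x y := by
    induction x using Quotient.inductionOn
    induction y using Quotient.inductionOn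
    exact congrArg (Quotient.mk _) (Singquandle.opl_star_opr _ _)

end PresentedSQ

/-! ## The singular braid monoid -/

/-- The generators `σ_i`, `σ_i⁻¹`, `τ_i` of the singular braid monoid on `n` strands. Strands are
numbered `0, …, n - 1`, and the index `i` refers to the strands in positions `i` and `i + 1`. -/
inductive SBGen (n : ℕ) : Type
  | sigma (i : ℕ) (h : i + 1 < n) : SBGen n
  | sigmaInv (i : ℕ) (h : i + 1 < n) : SBGen n
  | tau (i : ℕ) (h : i + 1 < n) : SBGen n

open FreeMonoid in
/-- The defining relations of the singular braid monoid. -/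
inductive SBRel (n : ℕ) : FreeMonoid (SBGen n) → FreeMonoid (SBGen n) → Prop
  | mul_inv (i h) : SBRel n (of (.sigma i h) * of (.sigmaInv i h)) 1
  | inv_mul (i h) : SBRel n (of (.sigmaInv i h) * of (.sigma i h)) 1
  | braid (i h h') :
      SBRel n (of (.sigma i h) * of (.sigma (i + 1) h') * of (.sigma i h))
        (of (.sigma (i + 1) h') * of (.sigma i h) * of (.sigma (i + 1) h'))
  | far_sigma_sigma (i j h h') (hij : i + 2 ≤ j ∨ j + 2 ≤ i) :
      SBRel n (of (.sigma i h) * of (.sigma j h')) (of (.sigma j h') * of (.sigma i h))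
  | far_tau_tau (i j h h') (hij : i + 2 ≤ j ∨ j + 2 ≤ i) :
      SBRel n (of (.tau i h) * of (.tau j h')) (of (.tau j h') * of (.tau i h))
  | far_tau_sigma (i j h h') (hij : i + 2 ≤ j ∨ j + 2 ≤ i) :
      SBRel n (of (.tau i h) * of (.sigma j h')) (of (.sigma j h') * of (.tau i h))
  | tau_sigma (i h) :
      SBRel n (of (.tau i h) * of (.sigma i h)) (of (.sigma i h) * of (.tau i h))
  | mixed_left (i h h') :
      SBRel n (of (.sigma i h) * of (.sigma (i + 1) h') * of (.tau i h))
        (of (.tau (i + 1) h') * of (.sigma i h) * of (.sigma (i + 1) h'))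
  | mixed_right (i h h') :
      SBRel n (of (.sigma (i + 1) h') * of (.sigma i h) * of (.tau (i + 1) h'))
        (of (.tau i h) * of (.sigma (i + 1) h') * of (.sigma i h))

/-- The singular braid monoid (Baez--Birman monoid) on `n` strands. -/
abbrev SingularBraidMonoid (n : ℕ) : Type := PresentedMonoid (SBRel n)

/-! ## The representation by endomorphisms of the free singquandle -/

/-- The free oriented singquandle of rank `n`. -/
abbrev FSQ (n : ℕ) : Type := FreeSQ (Fin n)

/-- Replace the entries `c i`, `c (i + 1)` of a tuple by `a`, `b`. -/
def replacePair {X : Type*} {n : ℕ} (i : ℕ) (a b : X) (c : Fin n → X) (j : Fin n) : X :=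
  if (j : ℕ) = i then a else if (j : ℕ) = i + 1 then b else c j

/-- The tuple of images of the free generators under the endomorphism assigned to a generator
of the singular braid monoid. -/
def phiGenTuple {X : Type*} [Singquandle X] {n : ℕ} (x : Fin n → X) : SBGen n → Fin n → X
  | .sigma i h =>
      let p := x ⟨i, by omega⟩
      let q := x ⟨i + 1, h⟩
      replacePair i q (p ⋆ q) x
  | .sigmaInv i h =>
      let p := x ⟨i, by omega⟩
      let q := x ⟨i + 1, h⟩
      replacePair i (q ⋆⁻ p) p x
  | .tau i h =>
      let p := x ⟨i, by omega⟩
      let q := x ⟨i + 1, h⟩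
      replacePair i (Singquandle.opl p q) (Singquandle.opr p q) x

def phiGen (n : ℕ) (g : SBGen n) : SQHom (FSQ n) (FSQ n) :=
  FreeSQ.lift (phiGenTuple FreeSQ.of g)

theorem SQHom.map_phiGenTuple {X Y : Type*} [Singquandle X] [Singquandle Y] {n : ℕ}
    (f : SQHom X Y) (x : Fin n → X) (g : SBGen n) (j : Fin n) :
    f.toFun (phiGenTuple x g j) = phiGenTuple (fun k => f.toFun (x k)) g j := by
  cases g <;> simp only [phiGenTuple, replacePair] <;> split_ifs <;>
    simp [f.map_star, f.map_bar, f.map_opl, f.map_opr]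

theorem phiGen_mul_toFun_of {n : ℕ} (f : SQHom (FSQ n) (FSQ n)) (g : SBGen n) (j : Fin n) :
    (f * phiGen n g).toFun (FreeSQ.of j) =
      phiGenTuple (fun k => f.toFun (FreeSQ.of k)) g j :=
  f.map_phiGenTuple _ _ _

theorem phiGen_toFun_of {n : ℕ} (g : SBGen n) (j : Fin n) :
    (phiGen n g).toFun (FreeSQ.of j) = phiGenTuple FreeSQ.of g j := rfl

/-- The third mixed axiom of a singquandle without the inverse operation. -/
theorem Singquandle.star_star_eq {X : Type*} [Singquandle X] (x y z : X) :
    (y ⋆ Singquandle.opl x z) ⋆ Singquandle.opr x z = (y ⋆ x) ⋆ z := by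
  have h := Singquandle.bar_star x (y ⋆ Singquandle.opl x z) z
  rw [Rack.left_inv (Singquandle.opl x z) y] at h
  rw [h, Rack.right_inv z]

theorem replacePair_fst {X : Type*} {n : ℕ} (i : ℕ) (a b : X) (c : Fin n → X) (h : i < n) :
    replacePair i a b c ⟨i, h⟩ = a := by
  simp [replacePair]

theorem replacePair_snd {X : Type*} {n : ℕ} (i : ℕ) (a b : X) (c : Fin n → X) (h : i + 1 < n) :
    replacePair i a b c ⟨i + 1, h⟩ = b := by
  simp [replacePair]

theorem replacePair_other {X : Type*} {n : ℕ} (i : ℕ) (a b : X) (c : Fin n → X) (j : ℕ)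
    (h : j < n) (h1 : j ≠ i) (h2 : j ≠ i + 1) : replacePair i a b c ⟨j, h⟩ = c ⟨j, h⟩ := by
  simp [replacePair, h1, h2]

theorem replacePair_comm {X : Type*} {n : ℕ} (i j : ℕ) (a b a' b' : X) (c : Fin n → X)
    (hij : i + 2 ≤ j ∨ j + 2 ≤ i) :
    replacePair i a b (replacePair j a' b' c) = replacePair j a' b' (replacePair i a b c) := by
  funext k
  simp only [replacePair]
  split_ifs <;> first | omega | rfl

theorem phiGen_rel_tuple {X : Type*} [Singquandle X] {n : ℕ} (x : Fin n → X)
    (u v : FreeMonoid (SBGen n)) (h : SBRel n u v) :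
    u.toList.foldl phiGenTuple x = v.toList.foldl phiGenTuple x := by
  have l1 : ∀ p q : X, (p ⋆ q) ⋆⁻ q = p := fun p q => Rack.left_inv q p
  have l2 : ∀ p q : X, (p ⋆⁻ q) ⋆ q = p := fun p q => Rack.right_inv q p
  have far : ∀ (i j : ℕ) (h : i + 1 < n) (h' : j + 1 < n) (a b : X),
      i + 2 ≤ j ∨ j + 2 ≤ i →
      replacePair i a b x ⟨j, by omega⟩ = x ⟨j, by omega⟩ ∧
      replacePair i a b x ⟨j + 1, h'⟩ = x ⟨j + 1, h'⟩ := fun i j h h' a b hij =>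
    ⟨replacePair_other _ _ _ _ _ _ (by omega) (by omega),
      replacePair_other _ _ _ _ _ _ (by omega) (by omega)⟩
  have two : ∀ (i : ℕ) (h : i + 1 < n) (a b a' b' : X) (c c' : Fin n → X),
      a = a' → b = b' → (∀ k : Fin n, (k : ℕ) ≠ i → (k : ℕ) ≠ i + 1 → c k = c' k) →
      replacePair i a b c = replacePair i a' b' c' := by
    intro i h a b a' b' c c' ha hb hc
    funext k
    simp only [replacePair]
    split_ifs with h1 h2
    · exact ha
    · exact hb
    · exact hc k h1 h2
  have self : ∀ (i : ℕ) (h : i + 1 < n) (a b : X) (c : Fin n → X),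
      a = x ⟨i, by omega⟩ → b = x ⟨i + 1, h⟩ →
      (∀ k : Fin n, (k : ℕ) ≠ i → (k : ℕ) ≠ i + 1 → c k = x k) → replacePair i a b c = x := by
    intro i h a b c ha hb hc
    funext k
    simp only [replacePair]
    split_ifs with h1 h2
    · exact ha.trans (congrArg x (Fin.ext h1.symm))
    · exact hb.trans (congrArg x (Fin.ext h2.symm))
    · exact hc k h1 h2
  have rest : ∀ (i : ℕ) (a b : X) (c : Fin n → X) (k : Fin n),
      (k : ℕ) ≠ i → (k : ℕ) ≠ i + 1 → replacePair i a b c k = c k := by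
    intro i a b c k h1 h2
    simp only [replacePair, h1, h2, if_false]
  have n1 : ∀ (i : ℕ) (h : i < n) (a b : X) (c : Fin n → X),
      replacePair (i + 1) a b c ⟨i, h⟩ = c ⟨i, h⟩ := fun i h a b c =>
    replacePair_other _ _ _ _ _ _ (by omega) (by omega)
  have n2 : ∀ (i : ℕ) (h : i + 1 + 1 < n) (a b : X) (c : Fin n → X),
      replacePair i a b c ⟨i + 1 + 1, h⟩ = c ⟨i + 1 + 1, h⟩ := fun i h a b c =>
    replacePair_other _ _ _ _ _ _ (by omega) (by omega)
  have three : ∀ (i : ℕ) (h : i + 1 + 1 < n) (y z : Fin n → X),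
      y ⟨i, by omega⟩ = z ⟨i, by omega⟩ → y ⟨i + 1, by omega⟩ = z ⟨i + 1, by omega⟩ →
      y ⟨i + 1 + 1, h⟩ = z ⟨i + 1 + 1, h⟩ →
      (∀ k : Fin n, (k : ℕ) ≠ i → (k : ℕ) ≠ i + 1 → (k : ℕ) ≠ i + 1 + 1 → y k = z k) →
      y = z := by
    intro i h y z ha hb hc hd
    funext k
    by_cases h1 : (k : ℕ) = i
    · obtain ⟨k, hk⟩ := k; subst h1; exact ha
    by_cases h2 : (k : ℕ) = i + 1
    · obtain ⟨k, hk⟩ := k; subst h2; exact hb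
    by_cases h3 : (k : ℕ) = i + 1 + 1
    · obtain ⟨k, hk⟩ := k; subst h3; exact hc
    exact hd k h1 h2 h3
  cases h with
  | far_sigma_sigma i j h h' hij =>
    simp only [FreeMonoid.toList_mul, FreeMonoid.toList_of, List.cons_append, List.nil_append,
      List.foldl_cons, List.foldl_nil, phiGenTuple, (far i j h h' _ _ hij).1,
      (far i j h h' _ _ hij).2, (far j i h' h _ _ hij.symm).1, (far j i h' h _ _ hij.symm).2]
    exact replacePair_comm _ _ _ _ _ _ _ hij.symm
  | far_tau_tau i j h h' hij =>
    simp only [FreeMonoid.toList_mul, FreeMonoid.toList_of, List.cons_append, List.nil_append,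
      List.foldl_cons, List.foldl_nil, phiGenTuple, (far i j h h' _ _ hij).1,
      (far i j h h' _ _ hij).2, (far j i h' h _ _ hij.symm).1, (far j i h' h _ _ hij.symm).2]
    exact replacePair_comm _ _ _ _ _ _ _ hij.symm
  | far_tau_sigma i j h h' hij =>
    simp only [FreeMonoid.toList_mul, FreeMonoid.toList_of, List.cons_append, List.nil_append,
      List.foldl_cons, List.foldl_nil, phiGenTuple, (far i j h h' _ _ hij).1,
      (far i j h h' _ _ hij).2, (far j i h' h _ _ hij.symm).1, (far j i h' h _ _ hij.symm).2]
    exact replacePair_comm _ _ _ _ _ _ _ hij.symm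
  | mul_inv i h =>
    simp only [FreeMonoid.toList_mul, FreeMonoid.toList_of, FreeMonoid.toList_one,
      List.cons_append, List.nil_append, List.foldl_cons, List.foldl_nil, phiGenTuple,
      replacePair_fst, replacePair_snd]
    exact self i h _ _ _ (l1 _ _) rfl (rest _ _ _ _)
  | inv_mul i h =>
    simp only [FreeMonoid.toList_mul, FreeMonoid.toList_of, FreeMonoid.toList_one,
      List.cons_append, List.nil_append, List.foldl_cons, List.foldl_nil, phiGenTuple,
      replacePair_fst, replacePair_snd]
    exact self i h _ _ _ rfl (l2 _ _) (rest _ _ _ _)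
  | tau_sigma i h =>
    simp only [FreeMonoid.toList_mul, FreeMonoid.toList_of, List.cons_append, List.nil_append,
      List.foldl_cons, List.foldl_nil, phiGenTuple, replacePair_fst, replacePair_snd]
    exact two i h _ _ _ _ _ _ (Singquandle.opr_eq _ _) (Singquandle.opl_star_opr _ _)
      (fun k h1 h2 => (rest _ _ _ _ k h1 h2).trans (rest _ _ _ _ k h1 h2).symm)
  | braid i h h' =>
    simp only [FreeMonoid.toList_mul, FreeMonoid.toList_of, List.cons_append, List.nil_append,
      List.foldl_cons, List.foldl_nil, phiGenTuple, replacePair_fst, replacePair_snd, n1, n2]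
    apply three i h' <;> try simp only [replacePair_fst, replacePair_snd, n1, n2]
    · exact Shelf.self_distrib (α := X)
    · intro k h1 h2 h3
      simp only [rest _ _ _ _ k h1 h2, rest _ _ _ _ k h2 h3]
  | mixed_left i h h' =>
    simp only [FreeMonoid.toList_mul, FreeMonoid.toList_of, List.cons_append, List.nil_append,
      List.foldl_cons, List.foldl_nil, phiGenTuple, replacePair_fst, replacePair_snd, n1, n2]
    apply three i h' <;> try simp only [replacePair_fst, replacePair_snd, n1, n2]
    · exact (Singquandle.star_star_eq _ _ _).symm
    · intro k h1 h2 h3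
      simp only [rest _ _ _ _ k h1 h2, rest _ _ _ _ k h2 h3]
  | mixed_right i h h' =>
    simp only [FreeMonoid.toList_mul, FreeMonoid.toList_of, List.cons_append, List.nil_append,
      List.foldl_cons, List.foldl_nil, phiGenTuple, replacePair_fst, replacePair_snd, n1, n2]
    apply three i h' <;> try simp only [replacePair_fst, replacePair_snd, n1, n2]
    · exact (Singquandle.opl_star _ _ _).symm
    · exact (Singquandle.opr_star _ _ _).symm
    · intro k h1 h2 h3
      simp only [rest _ _ _ _ k h1 h2, rest _ _ _ _ k h2 h3]

theorem foldl_phiGenTuple {n : ℕ} (f : SQHom (FSQ n) (FSQ n)) (w : FreeMonoid (SBGen n)) :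
    (fun j => (f * FreeMonoid.lift (phiGen n) w).toFun (FreeSQ.of j)) =
      w.toList.foldl phiGenTuple (fun j => f.toFun (FreeSQ.of j)) := by
  induction w using FreeMonoid.recOn generalizing f with
  | one => simp
  | of_mul g w ih =>
    rw [map_mul, FreeMonoid.lift_eval_of, ← mul_assoc, ih, FreeMonoid.toList_mul,
      FreeMonoid.toList_of, List.cons_append, List.nil_append, List.foldl_cons]
    congr 1
    funext j
    exact phiGen_mul_toFun_of f g j

theorem phiGen_rel (n : ℕ) (u v : FreeMonoid (SBGen n)) (h : SBRel n u v) :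
    FreeMonoid.lift (phiGen n) u = FreeMonoid.lift (phiGen n) v := by
  apply FreeSQ.hom_ext
  intro a
  have hu := congrFun (foldl_phiGenTuple 1 u) a
  have hv := congrFun (foldl_phiGenTuple 1 v) a
  rw [one_mul] at hu hv
  rw [hu, hv, phiGen_rel_tuple _ u v h]

/-- The representation `Φ : SB_n → End(FSQ_n)`. Endomorphisms are multiplied by composition,
so `Φ(αβ)(x) = Φ(α)(Φ(β)(x))`. -/
def Phi (n : ℕ) : SingularBraidMonoid n →* SQHom (FSQ n) (FSQ n) :=
  PresentedMonoid.lift (phiGen n) (phiGen_rel n)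

/-- The singquandle `⟨x_1, …, x_n | x_i = Φ(β)(x_i), i = 1, …, n⟩`. -/
abbrev SQPhi {n : ℕ} (β : SingularBraidMonoid n) : Type :=
  PresentedSQ (fun u v : FSQ n =>
    ∃ i : Fin n, u = FreeSQ.of i ∧ v = (Phi n β).toFun (FreeSQ.of i))

/-! ## Oriented singular link diagrams

A diagram in the plane is put in general position with respect to the height function and cut by
horizontal lines into elementary slices, each of which contains exactly one local extremum or one
crossing. It is read from top to bottom, and each strand carries a direction. -/

/-- The direction of a strand at a horizontal line: `true` is downward, `false` is upward. -/
abbrev Dir : Type := Bool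

/-- The kinds of crossings of two strands, one joining the top left to the bottom right corner,
and one joining the top right to the bottom left corner. -/
inductive CrossingKind : Type
  /-- The strand from the top right to the bottom left passes over. -/
  | overRL
  /-- The strand from the top left to the bottom right passes over. -/
  | overLR
  /-- A singular crossing. -/
  | sing

/-- Exchange over and under. -/
def CrossingKind.flip : CrossingKind → CrossingKind
  | .overRL => .overLR
  | .overLR => .overRL
  | .sing => .sing

/-- Elementary pieces of a diagram. -/
inductive Piece : Type
  /-- A local maximum; `d` is the direction of its left leg. -/
  | maximum (d : Dir)
  /-- A local minimum; `d` is the direction of its left leg. -/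
  | minimum (d : Dir)
  /-- A crossing; `d` and `e` are the directions of the strands which start at the
  top left and at the top right. -/
  | cross (k : CrossingKind) (d e : Dir)

/-- Directions at the upper boundary of a piece, from left to right. -/
def Piece.top : Piece → List Dir
  | .maximum _ => []
  | .minimum d => [d, !d]
  | .cross _ d e => [d, e]

/-- Directions at the lower boundary of a piece, from left to right. -/
def Piece.bot : Piece → List Dir
  | .maximum d => [d, !d]
  | .minimum _ => []
  | .cross _ d e => [e, d]

/-- A slice: one elementary piece with vertical strands to its left and to its right. -/
structure Slice : Type where
  left : List Dir
  piece : Piece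
  right : List Dir

namespace Slice

def top (s : Slice) : List Dir := s.left ++ s.piece.top ++ s.right

def bot (s : Slice) : List Dir := s.left ++ s.piece.bot ++ s.right

/-- Add vertical strands on both sides. -/
def pad (a b : List Dir) (s : Slice) : Slice := ⟨a ++ s.left, s.piece, s.right ++ b⟩

end Slice

/-- The slices `w`, stacked from top to bottom, fit together and have upper boundary `a` and lower
boundary `b`. -/
def IsTangle (a : List Dir) : List Slice → List Dir → Prop
  | [], b => a = b
  | s :: w, b => s.top = a ∧ IsTangle s.bot w b

/-- A diagram of an oriented singular link. -/
structure LinkDiagram : Type where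
  slices : List Slice
  closed : IsTangle [] slices []

/-- The local moves: planar isotopies and singular Reidemeister moves, for all choices
of directions of the strands. -/
inductive LocalMove : List Slice → List Slice → Prop
  /-- Planar isotopy: pieces side by side can be drawn at any relative height. -/
  | exchange (g h : Piece) (m : List Dir) :
      LocalMove [⟨[], g, m ++ h.top⟩, ⟨g.bot ++ m, h, []⟩]
        [⟨g.top ++ m, h, []⟩, ⟨[], g, m ++ h.bot⟩]
  /-- Planar isotopy: cancellation of a maximum and a minimum. -/
  | zigzag_left (d : Dir) :
      LocalMove [⟨[d], .maximum (!d), []⟩, ⟨[], .minimum d, [d]⟩] []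
  | zigzag_right (d : Dir) :
      LocalMove [⟨[], .maximum d, [d]⟩, ⟨[d], .minimum (!d), []⟩] []
  /-- Planar isotopy: a crossing of any kind is pulled through an extremum. -/
  | slide_minimum (k : CrossingKind) (d e : Dir) :
      LocalMove [⟨[d], .cross k e (!d), []⟩, ⟨[], .minimum d, [e]⟩]
        [⟨[], .cross k.flip d e, [!d]⟩, ⟨[e], .minimum d, []⟩]
  | slide_maximum (k : CrossingKind) (d e : Dir) :
      LocalMove [⟨[], .maximum d, [e]⟩, ⟨[d], .cross k (!d) e, []⟩]
        [⟨[e], .maximum d, []⟩, ⟨[], .cross k.flip e d, [!d]⟩]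
  /-- The first Reidemeister move. -/
  | reidemeister1_maximum (k : CrossingKind) (hk : k ≠ .sing) (d : Dir) :
      LocalMove [⟨[], .maximum d, []⟩, ⟨[], .cross k d (!d), []⟩] [⟨[], .maximum (!d), []⟩]
  | reidemeister1_minimum (k : CrossingKind) (hk : k ≠ .sing) (d : Dir) :
      LocalMove [⟨[], .cross k d (!d), []⟩, ⟨[], .minimum (!d), []⟩] [⟨[], .minimum d, []⟩]
  /-- The second Reidemeister move. -/
  | reidemeister2 (k : CrossingKind) (hk : k ≠ .sing) (d e : Dir) :
      LocalMove [⟨[], .cross k d e, []⟩, ⟨[], .cross k.flip e d, []⟩] []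
  /-- A strand passes over (or under) a crossing of kind `k'` from one side to the other:
  the third Reidemeister move if `k'` is classical, the fourth one if `k'` is singular. -/
  | pass_left (k k' : CrossingKind) (hk : k ≠ .sing) (d e f : Dir) :
      LocalMove
        [⟨[], .cross k d e, [f]⟩, ⟨[e], .cross k d f, []⟩, ⟨[], .cross k' e f, [d]⟩]
        [⟨[d], .cross k' e f, []⟩, ⟨[], .cross k d f, [e]⟩, ⟨[f], .cross k d e, []⟩]
  | pass_right (k k' : CrossingKind) (hk : k ≠ .sing) (d e f : Dir) :
      LocalMove
        [⟨[d], .cross k e f, []⟩, ⟨[], .cross k d f, [e]⟩, ⟨[f], .cross k' d e, []⟩]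
        [⟨[], .cross k' d e, [f]⟩, ⟨[e], .cross k d f, []⟩, ⟨[], .cross k e f, [d]⟩]
  /-- The fifth Reidemeister move: a classical crossing passes through a singular one. -/
  | reidemeister5 (k : CrossingKind) (hk : k ≠ .sing) (d e : Dir) :
      LocalMove [⟨[], .cross k d e, []⟩, ⟨[], .cross .sing e d, []⟩]
        [⟨[], .cross .sing d e, []⟩, ⟨[], .cross k e d, []⟩]

namespace LinkDiagram

/-- Two diagrams differ by one local move, with the same vertical strands `a`, `b` beside it and
the same slices `u`, `v` above and below it. -/
def Move (D D' : LinkDiagram) : Prop :=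
  ∃ (u v m m' : List Slice) (a b : List Dir), LocalMove m m' ∧
    D.slices = u ++ m.map (Slice.pad a b) ++ v ∧
    D'.slices = u ++ m'.map (Slice.pad a b) ++ v

end LinkDiagram

/-- Oriented singular links: equivalence classes of diagrams for the equivalence relation generated
by planar isotopy and singular Reidemeister moves. -/
def SingularLink : Type := Quot LinkDiagram.Move

/-- The singular link with diagram `D`. -/
def LinkDiagram.toLink (D : LinkDiagram) : SingularLink := Quot.mk _ D

/-! ## The fundamental oriented singquandle of a diagram -/

namespace LinkDiagram

/-- Directions along the horizontal line below the first `j` slices. -/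
def level (D : LinkDiagram) : ℕ → List Dir
  | 0 => []
  | j + 1 => (D.slices[j]?.map Slice.bot).getD []

/-- The points of a diagram on the horizontal lines between the slices; `(j, i)` is the `i`-th point
from the left on the line below the first `j` slices. -/
def Point (D : LinkDiagram) : Type := { v : ℕ × ℕ // v.2 < (D.level v.1).length }

/-- The piece in slice `j` is `g`, with `i` strands to its left. -/
def HasPiece (D : LinkDiagram) (j : ℕ) (g : Piece) (i : ℕ) : Prop :=
  ∃ s : Slice, D.slices[j]? = some s ∧ s.piece = g ∧ s.left.length = i

/-- The two points are joined by a segment of the diagram inside one slice which does not pass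
under a classical crossing or through a singular crossing. -/
inductive Joined (D : LinkDiagram) : D.Point → D.Point → Prop
  | left {j i i' : ℕ} {g : Piece} (hg : D.HasPiece j g i) (hi : i' < i) (x y : D.Point)
      (hx : x.1 = (j, i')) (hy : y.1 = (j + 1, i')) : Joined D x y
  | right {j i i' : ℕ} {g : Piece} (hg : D.HasPiece j g i) (x y : D.Point)
      (hx : x.1 = (j, i + g.top.length + i')) (hy : y.1 = (j + 1, i + g.bot.length + i')) :
      Joined D x y
  | maximum {j i : ℕ} {d : Dir} (hg : D.HasPiece j (.maximum d) i) (x y : D.Point)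
      (hx : x.1 = (j + 1, i)) (hy : y.1 = (j + 1, i + 1)) : Joined D x y
  | minimum {j i : ℕ} {d : Dir} (hg : D.HasPiece j (.minimum d) i) (x y : D.Point)
      (hx : x.1 = (j, i)) (hy : y.1 = (j, i + 1)) : Joined D x y
  | overRL {j i : ℕ} {d e : Dir} (hg : D.HasPiece j (.cross .overRL d e) i) (x y : D.Point)
      (hx : x.1 = (j, i + 1)) (hy : y.1 = (j + 1, i)) : Joined D x y
  | overLR {j i : ℕ} {d e : Dir} (hg : D.HasPiece j (.cross .overLR d e) i) (x y : D.Point)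
      (hx : x.1 = (j, i)) (hy : y.1 = (j + 1, i + 1)) : Joined D x y

/-- The arcs of a diagram: the connected components after cutting the diagram at the singular
crossings and cutting the lower strand at the classical crossings. -/
def Arc (D : LinkDiagram) : Type := Quot D.Joined

end LinkDiagram

/-- The relations of the colours of the arcs at a crossing with corners `p` (top left), `q`
(top right), `r` (bottom left), `s` (bottom right).

At a classical crossing with upper arc `y`, if `x` is the arc to the right of `y` (with respect to
the direction of `y`) and `z` is the arc to the left of `y`, then `z = x ⋆ y`.

At a singular crossing, turned so that both strands run downward, with arcs `x`, `y` at the top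
left and top right, the arcs at the bottom left and bottom right are `x ∘_l y` and `x ∘_r y`. -/
inductive CrossingRel {X : Type*} [Singquandle X] (p q r s : X) :
    CrossingKind → Dir → Dir → X → X → Prop
  | overRL_down (d : Dir) : CrossingRel p q r s .overRL d true s (p ⋆ q)
  | overRL_up (d : Dir) : CrossingRel p q r s .overRL d false p (s ⋆ q)
  | overLR_down (e : Dir) : CrossingRel p q r s .overLR true e q (r ⋆ p)
  | overLR_up (e : Dir) : CrossingRel p q r s .overLR false e r (q ⋆ p)
  | sing_down_left : CrossingRel p q r s .sing true true r (Singquandle.opl p q)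
  | sing_down_right : CrossingRel p q r s .sing true true s (Singquandle.opr p q)
  | sing_rightward_left : CrossingRel p q r s .sing true false s (Singquandle.opl r p)
  | sing_rightward_right : CrossingRel p q r s .sing true false q (Singquandle.opr r p)
  | sing_leftward_left : CrossingRel p q r s .sing false true p (Singquandle.opl q s)
  | sing_leftward_right : CrossingRel p q r s .sing false true r (Singquandle.opr q s)
  | sing_up_left : CrossingRel p q r s .sing false false q (Singquandle.opl s r)
  | sing_up_right : CrossingRel p q r s .sing false false p (Singquandle.opr s r)

namespace LinkDiagram

/-- The generator of the free singquandle which belongs to the arc through a point. -/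
def arcGen (D : LinkDiagram) (x : D.Point) : FreeSQ D.Arc := FreeSQ.of (Quot.mk _ x)

/-- The defining relations of the fundamental singquandle, from all crossings of the diagram. -/
def ArcRel (D : LinkDiagram) (u v : FreeSQ D.Arc) : Prop :=
  ∃ (j i : ℕ) (k : CrossingKind) (d e : Dir) (p q r s : D.Point),
    D.HasPiece j (.cross k d e) i ∧
    p.1 = (j, i) ∧ q.1 = (j, i + 1) ∧ r.1 = (j + 1, i) ∧ s.1 = (j + 1, i + 1) ∧
    CrossingRel (D.arcGen p) (D.arcGen q) (D.arcGen r) (D.arcGen s) k d e u v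

/-- The fundamental oriented singquandle of a diagram. -/
abbrev SQ (D : LinkDiagram) : Type := PresentedSQ D.ArcRel

end LinkDiagram

/-! ## Closures of singular braids -/

/-- The slice of a generator in the closure of a braid on `n` strands: the braid strands run
downward, and the `n` closing strands to their right run upward. In `σ_i` the strand from the top
right to the bottom left passes over. -/
def SBGen.slice {n : ℕ} : SBGen n → Slice
  | .sigma i _ =>
      ⟨.replicate i true, .cross .overRL true true, .replicate (n - (i + 2)) true ++ .replicate n false⟩
  | .sigmaInv i _ =>
      ⟨.replicate i true, .cross .overLR true true, .replicate (n - (i + 2)) true ++ .replicate n false⟩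
  | .tau i _ =>
      ⟨.replicate i true, .cross .sing true true, .replicate (n - (i + 2)) true ++ .replicate n false⟩

/-- `n` nested maxima (the outermost one first). -/
def nestedMaxima (n : ℕ) : List Slice :=
  (List.range n).map fun j => ⟨.replicate j true, .maximum true, .replicate j false⟩

/-- `n` nested minima (the innermost one first). -/
def nestedMinima (n : ℕ) : List Slice :=
  (List.range n).reverse.map fun j => ⟨.replicate j true, .minimum true, .replicate j false⟩

theorem IsTangle.append {a b c : List Dir} {w w' : List Slice} (h : IsTangle a w b)
    (h' : IsTangle b w' c) : IsTangle a (w ++ w') c := by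
  induction w generalizing a with
  | nil => cases h; exact h'
  | cons s w ih => exact ⟨h.1, ih h.2⟩

theorem isTangle_nestedMaxima (n : ℕ) :
    IsTangle [] (nestedMaxima n) (.replicate n true ++ .replicate n false) := by
  induction n with
  | zero => rfl
  | succ n ih =>
    rw [nestedMaxima, List.range_succ, List.map_append]
    refine ih.append ⟨by simp [Slice.top, Piece.top], ?_⟩
    simp [IsTangle, Slice.bot, Piece.bot, List.replicate_succ' (n := n) (a := true),
      List.replicate_succ (a := false)]

theorem isTangle_nestedMinima (n : ℕ) :
    IsTangle (.replicate n true ++ .replicate n false) (nestedMinima n) [] := by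
  induction n with
  | zero => rfl
  | succ n ih =>
    rw [nestedMinima, List.range_succ, List.reverse_append]
    refine ⟨?_, ?_⟩
    · simp [Slice.top, Piece.top, List.replicate_succ' (n := n) (a := true),
      List.replicate_succ (a := false)]
    · simpa [Slice.bot, Piece.bot, nestedMinima] using ih

theorem isTangle_braid {n : ℕ} (w : List (SBGen n)) :
    IsTangle (.replicate n true ++ .replicate n false) (w.map SBGen.slice)
      (.replicate n true ++ .replicate n false) := by
  have key : ∀ i, i + 1 < n → List.replicate i true ++ true :: true ::
      (List.replicate (n - (i + 2)) true ++ List.replicate n false) =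
      List.replicate n true ++ List.replicate n false := by
    intro i h
    have h1 : true :: true :: (List.replicate (n - (i + 2)) true ++ List.replicate n false) =
        List.replicate (n - (i + 2) + 1 + 1) true ++ List.replicate n false := rfl
    rw [h1, ← List.append_assoc, List.replicate_append_replicate]
    congr 2
    omega
  induction w with
  | nil => rfl
  | cons g w ih =>
    cases g with
    | sigma i h => exact ⟨by simpa [SBGen.slice, Slice.top, Piece.top] using key i h,
        by simpa [SBGen.slice, Slice.bot, Piece.bot, key i h] using ih⟩
    | sigmaInv i h => exact ⟨by simpa [SBGen.slice, Slice.top, Piece.top] using key i h,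
        by simpa [SBGen.slice, Slice.bot, Piece.bot, key i h] using ih⟩
    | tau i h => exact ⟨by simpa [SBGen.slice, Slice.top, Piece.top] using key i h,
        by simpa [SBGen.slice, Slice.bot, Piece.bot, key i h] using ih⟩

/-- The standard diagram of the closure of a singular braid word, read from top to bottom. -/
def closureDiagram {n : ℕ} (w : FreeMonoid (SBGen n)) : LinkDiagram where
  slices := nestedMaxima n ++ (w.toList.map SBGen.slice ++ nestedMinima n)
  closed := (isTangle_nestedMaxima n).append
    ((isTangle_braid w.toList).append (isTangle_nestedMinima n))

/-- The singular link `L` is the closure of the singular braid `β`. -/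
def IsClosure {n : ℕ} (β : SingularBraidMonoid n) (L : SingularLink) : Prop :=
  ∃ w : FreeMonoid (SBGen n), PresentedMonoid.mk (SBRel n) w = β ∧ (closureDiagram w).toLink = L

/-!
The theorem is proved by comparing functors. For a singquandle `X`, an `X`-colouring of a diagram
assigns an element of `X` to each point on the horizontal lines between the slices, subject to a
condition at each slice (`TangleColouring`). A colouring is stored as the list of its levels, so
that colourings form a functor `ListFamily` from singquandles to sets, and `IsUniversal` says that
a singquandle represents such a functor. Representing objects are unique up to isomorphism
(`IsUniversal.nonempty_equiv`) and stay representing under natural bijections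
(`IsUniversal.transfer`), so only natural bijections between sets of colourings are needed.

* The fundamental singquandle of a diagram represents its colourings
  (`LinkDiagram.isUniversal_SQ`).
* In every local move, the colours on the boundary of the part which is changed determine the
  colours inside, before and after the move, and the two parts impose the same condition on their
  boundary (`LocalMove.colourEquivalent`). Hence the colourings of both diagrams correspond to the
  same colours outside that part, and the fundamental singquandle is an invariant of links
  (`LinkDiagram.nonempty_equiv_of_toLink_eq`). The singquandle axioms enter here: passing a strand
  over a crossing uses that translations are automorphisms, passing it under a singular crossing
  uses the mixed axiom (`CrossingColouring.under`), and the fifth Reidemeister move uses the two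
  axioms which express `∘_r` and its twist (`singular_twist`).
* Running down a braid changes the colours of its strands by `phiGenTuple`, one generator at a time
  (`sliceColouring_slice`), and closing the braid identifies the colours at the bottom with those at
  the top. So colourings of the closure are the tuples fixed by the braid word
  (`tangleColouring_closureDiagram`), and these are represented by the singquandle with generators
  `x_i` and relations `x_i = Φ(β)(x_i)` (`isUniversal_SQPhi`).
-/

/-! ### Universal families of elements -/

namespace SQHom

variable {X Y Z : Type*} [Singquandle X] [Singquandle Y] [Singquandle Z]

/-- Composition of homomorphisms of singquandles. -/
def comp (g : SQHom Y Z) (f : SQHom X Y) : SQHom X Z where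
  toFun x := g.toFun (f.toFun x)
  map_star x y := by rw [f.map_star, g.map_star]
  map_opl x y := by rw [f.map_opl, g.map_opl]
  map_opr x y := by rw [f.map_opr, g.map_opr]

/-- A homomorphism applied to all entries of a list of lists. -/
def mapLists (f : SQHom X Y) (l : List (List X)) : List (List Y) := l.map (List.map f.toFun)

theorem mapLists_comp (g : SQHom Y Z) (f : SQHom X Y) (l : List (List X)) :
    (g.comp f).mapLists l = g.mapLists (f.mapLists l) := by
  simp [mapLists, comp, Function.comp_def]

theorem mapLists_one (l : List (List X)) : (1 : SQHom X X).mapLists l = l := by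
  have h : (1 : SQHom X X).toFun = id := rfl
  simp [mapLists, h]

end SQHom

/-- A condition on lists of lists of elements of an arbitrary singquandle. It is read as a functor
from singquandles to sets: `P X` is the set of lists in `X` which satisfy the condition. -/
abbrev ListFamily : Type 1 := ∀ (X : Type) [Singquandle X], List (List X) → Prop

/-- The pair `(Q, κ)` represents the functor `P`: the list `κ` in `Q` satisfies `P`, and each list
with this property in a singquandle `X` is the image of `κ` under exactly one homomorphism. -/
structure IsUniversal (P : ListFamily) (Q : Type) [Singquandle Q] (κ : List (List Q)) : Prop where
  mem : P Q κ
  existsUnique : ∀ (X : Type) [Singquandle X] (c : List (List X)), P X c →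
    ∃! f : SQHom Q X, f.mapLists κ = c

namespace IsUniversal

variable {P P' : ListFamily} {Q Q' : Type} [Singquandle Q] [Singquandle Q']
  {κ : List (List Q)} {κ' : List (List Q')}

theorem comp_eq_one (h : IsUniversal P Q κ) (f : SQHom Q Q') (g : SQHom Q' Q)
    (hf : f.mapLists κ = κ') (hg : g.mapLists κ' = κ) : g.comp f = 1 :=
  (h.existsUnique Q κ h.mem).unique (by rw [SQHom.mapLists_comp, hf, hg]) (SQHom.mapLists_one κ)

/-- Two singquandles which represent the same functor are isomorphic. -/
theorem nonempty_equiv (h : IsUniversal P Q κ) (h' : IsUniversal P Q' κ') :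
    Nonempty (SQEquiv Q Q') := by
  obtain ⟨f, hf, -⟩ := h.existsUnique Q' κ' h'.mem
  obtain ⟨g, hg, -⟩ := h'.existsUnique Q κ h.mem
  exact ⟨{
    toFun := f.toFun
    invFun := g.toFun
    left_inv := fun x => congrArg (fun k : SQHom Q Q => k.toFun x) (h.comp_eq_one f g hf hg)
    right_inv := fun x => congrArg (fun k : SQHom Q' Q' => k.toFun x) (h'.comp_eq_one g f hg hf)
    map_star := f.map_star
    map_opl := f.map_opl
    map_opr := f.map_opr }⟩

/-- A natural bijection `φ` from the functor `P` to the functor `P'` turns a universal element of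
the one into a universal element of the other. -/
theorem transfer (h : IsUniversal P Q κ) (φ : ∀ X : Type, List (List X) → List (List X))
    (natural : ∀ (X Y : Type) [Singquandle X] [Singquandle Y] (f : SQHom X Y) (c),
      φ Y (f.mapLists c) = f.mapLists (φ X c))
    (map_mem : ∀ (X Y : Type) [Singquandle X] [Singquandle Y] (f : SQHom X Y) (c),
      P X c → P Y (f.mapLists c))
    (mem : ∀ (X : Type) [Singquandle X] (c), P X c → P' X (φ X c))
    (inj : ∀ (X : Type) [Singquandle X] (c c'), P X c → P X c' → φ X c = φ X c' → c = c')
    (surj : ∀ (X : Type) [Singquandle X] (o), P' X o → ∃ c, P X c ∧ φ X c = o) :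
    IsUniversal P' Q (φ Q κ) where
  mem := mem Q κ h.mem
  existsUnique X _ o ho := by
    obtain ⟨c, hc, rfl⟩ := surj X o ho
    obtain ⟨f, hf, hu⟩ := h.existsUnique X c hc
    refine ⟨f, (natural Q X f κ).symm.trans (congrArg (φ X) hf), fun g hg => hu g ?_⟩
    exact inj X _ _ (map_mem Q X g κ h.mem) hc (by rw [natural, hg])

end IsUniversal

namespace PresentedSQ

variable {α : Type*} {r : FreeSQ α → FreeSQ α → Prop} {X : Type*} [Singquandle X]

variable (r) in
/-- The quotient map from the free singquandle. -/
def mkHom : SQHom (FreeSQ α) (PresentedSQ r) where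
  toFun := Quotient.mk (SQCon.setoid r)
  map_star _ _ := rfl
  map_opl _ _ := rfl
  map_opr _ _ := rfl

theorem mkHom_eq {u v : FreeSQ α} (h : r u v) : (mkHom r).toFun u = (mkHom r).toFun v :=
  Quotient.sound (SQCon.of h)

theorem eq_of_con (f : SQHom (FreeSQ α) X) (hf : ∀ u v, r u v → f.toFun u = f.toFun v)
    {u v : FreeSQ α} (h : SQCon r u v) : f.toFun u = f.toFun v := by
  induction h with
  | of h => exact hf _ _ h
  | refl => rfl
  | symm _ ih => exact ih.symm
  | trans _ _ ih1 ih2 => exact ih1.trans ih2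
  | star _ _ ih1 ih2 => rw [f.map_star, f.map_star, ih1, ih2]
  | bar _ _ ih1 ih2 => rw [f.map_bar, f.map_bar, ih1, ih2]
  | opl _ _ ih1 ih2 => rw [f.map_opl, f.map_opl, ih1, ih2]
  | opr _ _ ih1 ih2 => rw [f.map_opr, f.map_opr, ih1, ih2]

/-- The homomorphism from a presented singquandle induced by a homomorphism from the free one
which respects the relations. -/
def lift (f : SQHom (FreeSQ α) X) (hf : ∀ u v, r u v → f.toFun u = f.toFun v) :
    SQHom (PresentedSQ r) X where
  toFun := Quotient.lift f.toFun (fun _ _ h => eq_of_con f hf h)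
  map_star x y := by
    induction x using Quotient.inductionOn
    induction y using Quotient.inductionOn
    exact f.map_star _ _
  map_opl x y := by
    induction x using Quotient.inductionOn
    induction y using Quotient.inductionOn
    exact f.map_opl _ _
  map_opr x y := by
    induction x using Quotient.inductionOn
    induction y using Quotient.inductionOn
    exact f.map_opr _ _

theorem hom_ext {f g : SQHom (PresentedSQ r) X}
    (h : ∀ a, f.toFun ((mkHom r).toFun (FreeSQ.of a)) = g.toFun ((mkHom r).toFun (FreeSQ.of a))) :
    f = g := by
  have key : f.comp (mkHom r) = g.comp (mkHom r) := FreeSQ.hom_ext h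
  ext x
  induction x using Quotient.inductionOn with
  | h u => exact congrArg (fun k : SQHom (FreeSQ α) X => k.toFun u) key

end PresentedSQ

/-! ### Colourings of slices and of tangles -/

/-- The quandle operation (`ε = true`) or its inverse (`ε = false`). A strand which passes under a
strand of colour `y` from right to left changes its colour from `x` to `signedStar true x y`. -/
def signedStar {X : Type*} [Singquandle X] (ε : Bool) (x y : X) : X :=
  if ε then x ⋆ y else x ⋆⁻ y

section SignedStar

variable {X Y : Type*} [Singquandle X] [Singquandle Y]

theorem bar_eq_iff {x y z : X} : x ⋆⁻ y = z ↔ x = z ⋆ y := by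
  constructor
  · rintro rfl; exact (Rack.right_inv y x).symm
  · rintro rfl; exact Rack.left_inv y z

theorem signedStar_self (ε : Bool) (x : X) : signedStar ε x x = x := by
  cases ε
  · simp only [signedStar, Bool.false_eq_true, if_false]
    rw [bar_eq_iff]
    exact Quandle.fix.symm
  · exact Quandle.fix

theorem signedStar_cancel (ε : Bool) (x y : X) :
    signedStar ε (signedStar (!ε) x y) y = x := by
  cases ε
  · exact Rack.left_inv _ _
  · exact Rack.right_inv _ _

theorem signedStar_not_cancel (ε : Bool) (x y : X) :
    signedStar (!ε) (signedStar ε x y) y = x := by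
  simpa using signedStar_cancel (!ε) x y

theorem eq_signedStar_iff (ε : Bool) (x y z : X) :
    x = signedStar ε z y ↔ z = signedStar (!ε) x y := by
  constructor
  · rintro rfl; rw [signedStar_not_cancel]
  · rintro rfl; rw [signedStar_cancel]

theorem signedStar_inj (ε : Bool) (x y z : X) : signedStar ε x z = signedStar ε y z ↔ x = y := by
  refine ⟨fun h => ?_, fun h => h ▸ rfl⟩
  rw [eq_signedStar_iff, signedStar_not_cancel] at h
  exact h.symm

/-- All translations, and their inverses, are automorphisms for `⋆` and `⋆⁻`. -/
theorem signedStar_distrib (ε δ : Bool) (x y z : X) :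
    signedStar ε (signedStar δ x y) z = signedStar δ (signedStar ε x z) (signedStar ε y z) := by
  have pos : ∀ (δ : Bool) (x y z : X),
      signedStar δ x y ⋆ z = signedStar δ (x ⋆ z) (y ⋆ z) := by
    intro δ x y z
    cases δ
    · change (x ⋆⁻ y) ⋆ z = (x ⋆ z) ⋆⁻ (y ⋆ z)
      symm
      rw [bar_eq_iff, ← Shelf.self_distrib, Rack.right_inv]
    · exact Shelf.self_distrib
  cases ε
  · change signedStar δ x y ⋆⁻ z = signedStar δ (x ⋆⁻ z) (y ⋆⁻ z)
    rw [bar_eq_iff, pos, Rack.right_inv, Rack.right_inv]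
  · exact pos δ x y z

theorem signedStar_opl (ε : Bool) (x y z : X) : signedStar ε (Singquandle.opl x y) z =
    Singquandle.opl (signedStar ε x z) (signedStar ε y z) := by
  cases ε
  · exact Singquandle.opl_bar x y z
  · exact Singquandle.opl_star x y z

theorem signedStar_opr (ε : Bool) (x y z : X) : signedStar ε (Singquandle.opr x y) z =
    Singquandle.opr (signedStar ε x z) (signedStar ε y z) := by
  cases ε
  · exact Singquandle.opr_bar x y z
  · exact Singquandle.opr_star x y z

theorem SQHom.map_signedStar (f : SQHom X Y) (ε : Bool) (x y : X) :
    f.toFun (signedStar ε x y) = signedStar ε (f.toFun x) (f.toFun y) := by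
  cases ε
  · exact f.map_bar x y
  · exact f.map_star x y

end SignedStar

/-- The condition on the colours `p` (top left), `q` (top right), `r` (bottom left) and `s` (bottom
right) at a crossing. At a classical crossing it exhibits `r` and `s` as functions of `p` and `q`;
at a singular crossing it is the defining relation after turning both strands downward. -/
def CrossingColouring {X : Type*} [Singquandle X] :
    CrossingKind → Dir → Dir → X → X → X → X → Prop
  | .overRL, _, e, p, q, r, s => r = q ∧ s = signedStar e p q
  | .overLR, d, _, p, q, r, s => r = signedStar (!d) q p ∧ s = p
  | .sing, true, true, p, q, r, s => r = Singquandle.opl p q ∧ s = Singquandle.opr p q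
  | .sing, true, false, p, q, r, s => s = Singquandle.opl r p ∧ q = Singquandle.opr r p
  | .sing, false, true, p, q, r, s => p = Singquandle.opl q s ∧ r = Singquandle.opr q s
  | .sing, false, false, p, q, r, s => q = Singquandle.opl s r ∧ p = Singquandle.opr s r

/-- The condition on the colours of the upper and the lower ends of an elementary piece. -/
def PieceColouring {X : Type*} [Singquandle X] : Piece → List X → List X → Prop
  | .maximum _, t, b => t = [] ∧ ∃ x, b = [x, x]
  | .minimum _, t, b => (∃ x, t = [x, x]) ∧ b = []
  | .cross k d e, t, b => ∃ p q r s, t = [p, q] ∧ b = [r, s] ∧ CrossingColouring k d e p q r s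

/-- The condition on the colours `t` and `b` on the horizontal lines above and below a slice. -/
def SliceColouring {X : Type*} [Singquandle X] (s : Slice) (t b : List X) : Prop :=
  ∃ cl ct cb cr : List X, cl.length = s.left.length ∧ cr.length = s.right.length ∧
    t = cl ++ (ct ++ cr) ∧ b = cl ++ (cb ++ cr) ∧ PieceColouring s.piece ct cb

/-- `TangleColouring w t l`: if the strands above the slices `w` have the colours `t`, then the
lists in `l` are admissible colours on the horizontal lines below the slices of `w`. -/
def TangleColouring {X : Type*} [Singquandle X] : List Slice → List X → List (List X) → Prop
  | [], _, l => l = []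
  | _ :: _, _, [] => False
  | s :: w, t, c :: l => SliceColouring s t c ∧ TangleColouring w c l

section Colouring

variable {X Y : Type*} [Singquandle X] [Singquandle Y]

theorem CrossingColouring.map (f : SQHom X Y) {k : CrossingKind} {d e : Dir} {p q r s : X}
    (h : CrossingColouring k d e p q r s) :
    CrossingColouring k d e (f.toFun p) (f.toFun q) (f.toFun r) (f.toFun s) := by
  cases k <;> cases d <;> cases e <;> obtain ⟨rfl, rfl⟩ := h <;>
    simp [CrossingColouring, f.map_signedStar, f.map_opl, f.map_opr]

theorem PieceColouring.map (f : SQHom X Y) {g : Piece} {t b : List X}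
    (h : PieceColouring g t b) : PieceColouring g (t.map f.toFun) (b.map f.toFun) := by
  cases g with
  | maximum d => obtain ⟨rfl, x, rfl⟩ := h; exact ⟨rfl, _, rfl⟩
  | minimum d => obtain ⟨⟨x, rfl⟩, rfl⟩ := h; exact ⟨⟨_, rfl⟩, rfl⟩
  | cross k d e =>
    obtain ⟨p, q, r, s, rfl, rfl, h⟩ := h
    exact ⟨_, _, _, _, rfl, rfl, h.map f⟩

theorem SliceColouring.map (f : SQHom X Y) {s : Slice} {t b : List X}
    (h : SliceColouring s t b) : SliceColouring s (t.map f.toFun) (b.map f.toFun) := by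
  obtain ⟨cl, ct, cb, cr, hl, hr, rfl, rfl, h⟩ := h
  exact ⟨cl.map f.toFun, ct.map f.toFun, cb.map f.toFun, cr.map f.toFun, by simpa, by simpa,
    by simp, by simp, h.map f⟩

theorem TangleColouring.map (f : SQHom X Y) {w : List Slice} {t : List X} {l : List (List X)}
    (h : TangleColouring w t l) : TangleColouring w (t.map f.toFun) (f.mapLists l) := by
  induction w generalizing t l with
  | nil => cases h; rfl
  | cons s w ih =>
    cases l with
    | nil => exact h.elim
    | cons c l => exact ⟨h.1.map f, ih h.2⟩

theorem PieceColouring.length_top {g : Piece} {t b : List X} (h : PieceColouring g t b) :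
    t.length = g.top.length := by
  cases g with
  | maximum d => obtain ⟨rfl, x, rfl⟩ := h; rfl
  | minimum d => obtain ⟨⟨x, rfl⟩, rfl⟩ := h; rfl
  | cross k d e => obtain ⟨p, q, r, s, rfl, rfl, h⟩ := h; rfl

theorem PieceColouring.length_bot {g : Piece} {t b : List X} (h : PieceColouring g t b) :
    b.length = g.bot.length := by
  cases g with
  | maximum d => obtain ⟨rfl, x, rfl⟩ := h; rfl
  | minimum d => obtain ⟨⟨x, rfl⟩, rfl⟩ := h; rfl
  | cross k d e => obtain ⟨p, q, r, s, rfl, rfl, h⟩ := h; rfl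

theorem SliceColouring.length_bot {s : Slice} {t b : List X} (h : SliceColouring s t b) :
    b.length = s.bot.length := by
  obtain ⟨cl, ct, cb, cr, hl, hr, rfl, rfl, h⟩ := h
  simp [Slice.bot, hl, hr, h.length_bot]

/-- If the colours on the upper line are already split according to the slice, then the colours on
the lower line arise by recolouring the ends of the piece. -/
theorem sliceColouring_iff {left right : List Dir} {g : Piece} {cl ct cr : List X}
    (hl : cl.length = left.length) (ht : ct.length = g.top.length)
    (hr : cr.length = right.length) {b : List X} :
    SliceColouring ⟨left, g, right⟩ (cl ++ (ct ++ cr)) b ↔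
      ∃ cb, b = cl ++ (cb ++ cr) ∧ PieceColouring g ct cb := by
  constructor
  · rintro ⟨cl', ct', cb', cr', hl', hr', h1, rfl, h⟩
    obtain ⟨rfl, h2⟩ := List.append_inj h1 (hl.trans hl'.symm)
    obtain ⟨rfl, rfl⟩ := List.append_inj h2 (ht.trans h.length_top.symm)
    exact ⟨cb', rfl, h⟩
  · rintro ⟨cb, rfl, h⟩
    exact ⟨cl, ct, cb, cr, hl, hr, rfl, rfl, h⟩

theorem TangleColouring.length_eq {w : List Slice} {t : List X} {l : List (List X)}
    (h : TangleColouring w t l) : l.length = w.length := by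
  induction w generalizing t l with
  | nil => cases h; rfl
  | cons s w ih =>
    cases l with
    | nil => exact h.elim
    | cons c l => simpa using ih h.2

theorem tangleColouring_append {u v : List Slice} {t : List X} {l : List (List X)} :
    TangleColouring (u ++ v) t l ↔ ∃ l₁ l₂, l = l₁ ++ l₂ ∧ TangleColouring u t l₁ ∧
      TangleColouring v (l₁.getLastD t) l₂ := by
  induction u generalizing t l with
  | nil =>
    constructor
    · exact fun h => ⟨[], l, rfl, rfl, h⟩
    · rintro ⟨l₁, l₂, rfl, rfl, h⟩
      exact h
  | cons s u ih =>
    cases l with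
    | nil =>
      refine ⟨fun h => h.elim, ?_⟩
      rintro ⟨l₁, l₂, h, h1, -⟩
      obtain ⟨rfl, -⟩ := List.append_eq_nil_iff.1 h.symm
      exact h1.elim
    | cons c l =>
      constructor
      · rintro ⟨h, h'⟩
        obtain ⟨l₁, l₂, rfl, h1, h2⟩ := ih.1 h'
        exact ⟨c :: l₁, l₂, rfl, ⟨h, h1⟩, by rwa [List.getLastD_cons]⟩
      · rintro ⟨l₁, l₂, hl, h1, h2⟩
        cases l₁ with
        | nil => exact h1.elim
        | cons c' l₁ =>
          obtain ⟨rfl, rfl⟩ := List.cons_eq_cons.1 hl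
          rw [List.getLastD_cons] at h2
          exact ⟨h1.1, ih.2 ⟨l₁, l₂, rfl, h1.2, h2⟩⟩

theorem TangleColouring.length_last {w : List Slice} {α β : List Dir} (hw : IsTangle α w β)
    {t : List X} (ht : t.length = α.length) {l : List (List X)} (h : TangleColouring w t l) :
    (l.getLastD t).length = β.length := by
  induction w generalizing α t l with
  | nil => cases h; cases hw; exact ht
  | cons s w ih =>
    cases l with
    | nil => exact h.elim
    | cons c l =>
      rw [List.getLastD_cons]
      exact ih hw.2 h.1.length_bot h.2

/-- Dropping the first `l.length` of the lines `t :: (l ++ l')` leaves the last line of `t :: l` in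
front. -/
theorem drop_cons_append_length {α : Type*} (t : α) (l l' : List α) :
    (t :: (l ++ l')).drop l.length = l.getLastD t :: l' := by
  induction l generalizing t with
  | nil => rfl
  | cons c l ih => rw [List.getLastD_cons]; exact ih c

end Colouring

/-! ### The fundamental singquandle represents the colourings of a diagram -/

/-- The colourings of the tangle `w` with no upper ends. -/
def colourings (w : List Slice) : ListFamily := fun _ _ l => TangleColouring w [] l

section CrossingRel

variable {X Y : Type*} [Singquandle X] [Singquandle Y]

theorem crossingColouring_iff {k : CrossingKind} {d e : Dir} {p q r s : X} :
    CrossingColouring k d e p q r s ↔ (k = .overRL → q = r) ∧ (k = .overLR → p = s) ∧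
      ∀ u v, CrossingRel p q r s k d e u v → u = v := by
  constructor
  · intro h
    refine ⟨?_, ?_, ?_⟩
    · rintro rfl; exact h.1.symm
    · rintro rfl; exact h.2.symm
    · intro u v huv
      cases huv with
      | overRL_down d => exact h.2
      | overRL_up d => exact (eq_signedStar_iff false s q p).1 h.2
      | overLR_down e =>
        obtain ⟨h, rfl⟩ := h
        exact (eq_signedStar_iff false r s q).1 h
      | overLR_up e =>
        obtain ⟨h, rfl⟩ := h
        exact h
      | sing_down_left => exact h.1
      | sing_down_right => exact h.2
      | sing_rightward_left => exact h.1
      | sing_rightward_right => exact h.2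
      | sing_leftward_left => exact h.1
      | sing_leftward_right => exact h.2
      | sing_up_left => exact h.1
      | sing_up_right => exact h.2
  · rintro ⟨h₁, h₂, h⟩
    cases k with
    | overRL =>
      refine ⟨(h₁ rfl).symm, ?_⟩
      cases e
      · exact (eq_signedStar_iff true p q s).1 (h _ _ (.overRL_up d))
      · exact h _ _ (.overRL_down d)
    | overLR =>
      obtain rfl := h₂ rfl
      refine ⟨?_, rfl⟩
      cases d
      · exact h _ _ (.overLR_up e)
      · exact (eq_signedStar_iff true q p r).1 (h _ _ (.overLR_down e))
    | sing =>
      cases d <;> cases e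
      · exact ⟨h _ _ .sing_up_left, h _ _ .sing_up_right⟩
      · exact ⟨h _ _ .sing_leftward_left, h _ _ .sing_leftward_right⟩
      · exact ⟨h _ _ .sing_rightward_left, h _ _ .sing_rightward_right⟩
      · exact ⟨h _ _ .sing_down_left, h _ _ .sing_down_right⟩

theorem CrossingRel.map (f : SQHom X Y) {k : CrossingKind} {d e : Dir} {p q r s u v : X}
    (h : CrossingRel p q r s k d e u v) :
    CrossingRel (f.toFun p) (f.toFun q) (f.toFun r) (f.toFun s) k d e (f.toFun u) (f.toFun v) := by
  cases h <;> simp only [f.map_star, f.map_opl, f.map_opr] <;> constructor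

/-- The relations at the image of a crossing are images of relations. -/
theorem CrossingRel.exists_of_map (f : SQHom X Y) {k : CrossingKind} {d e : Dir} {p q r s : X}
    {u' v' : Y} (h : CrossingRel (f.toFun p) (f.toFun q) (f.toFun r) (f.toFun s) k d e u' v') :
    ∃ u v, CrossingRel p q r s k d e u v ∧ f.toFun u = u' ∧ f.toFun v = v' := by
  cases h with
  | overRL_down d => exact ⟨_, _, .overRL_down d, rfl, f.map_star _ _⟩
  | overRL_up d => exact ⟨_, _, .overRL_up d, rfl, f.map_star _ _⟩
  | overLR_down e => exact ⟨_, _, .overLR_down e, rfl, f.map_star _ _⟩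
  | overLR_up e => exact ⟨_, _, .overLR_up e, rfl, f.map_star _ _⟩
  | sing_down_left => exact ⟨_, _, .sing_down_left, rfl, f.map_opl _ _⟩
  | sing_down_right => exact ⟨_, _, .sing_down_right, rfl, f.map_opr _ _⟩
  | sing_rightward_left => exact ⟨_, _, .sing_rightward_left, rfl, f.map_opl _ _⟩
  | sing_rightward_right => exact ⟨_, _, .sing_rightward_right, rfl, f.map_opr _ _⟩
  | sing_leftward_left => exact ⟨_, _, .sing_leftward_left, rfl, f.map_opl _ _⟩
  | sing_leftward_right => exact ⟨_, _, .sing_leftward_right, rfl, f.map_opr _ _⟩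
  | sing_up_left => exact ⟨_, _, .sing_up_left, rfl, f.map_opl _ _⟩
  | sing_up_right => exact ⟨_, _, .sing_up_right, rfl, f.map_opr _ _⟩

end CrossingRel

theorem tangleColouring_iff_getElem {X : Type*} [Singquandle X] {w : List Slice} {t : List X}
    {l : List (List X)} : TangleColouring w t l ↔ l.length = w.length ∧
      ∀ j s, w[j]? = some s → SliceColouring s ((t :: l).getD j []) (l.getD j []) := by
  induction w generalizing t l with
  | nil => simp [TangleColouring]
  | cons s w ih =>
    cases l with
    | nil => simp [TangleColouring]
    | cons c l =>
      change _ ∧ TangleColouring w c l ↔ _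
      rw [ih, List.length_cons, List.length_cons, add_left_inj]
      constructor
      · rintro ⟨h, hl, h'⟩
        refine ⟨hl, fun j s' hj => ?_⟩
        cases j with
        | zero =>
          obtain rfl : s = s' := by simpa using hj
          exact h
        | succ j => exact h' j s' (by simpa using hj)
      · rintro ⟨hl, h⟩
        exact ⟨h 0 s rfl, hl, fun j s' hj => h (j + 1) s' (by simpa using hj)⟩

theorem IsTangle.getElem_top {w : List Slice} {α β : List Dir} (h : IsTangle α w β) {j : ℕ}
    {s : Slice} (hj : w[j]? = some s) : (α :: w.map Slice.bot)[j]? = some s.top := by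
  induction w generalizing α j with
  | nil => simp at hj
  | cons s' w ih =>
    cases j with
    | zero =>
      obtain rfl : s' = s := by simpa using hj
      rw [← h.1]
      rfl
    | succ j => exact ih h.2 (by simpa using hj)

namespace LinkDiagram

variable (D : LinkDiagram) {X Y : Type*}

theorem level_of_getElem {j : ℕ} {s : Slice} (hj : D.slices[j]? = some s) :
    D.level j = s.top := by
  have h := D.closed.getElem_top hj
  cases j with
  | zero => simpa [level] using h
  | succ j =>
    rw [List.getElem?_cons_succ, List.getElem?_map] at h
    simp [level, h]

theorem level_succ_of_getElem {j : ℕ} {s : Slice} (hj : D.slices[j]? = some s) :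
    D.level (j + 1) = s.bot := by
  simp [level, hj]

theorem level_succ_of_le {j : ℕ} (hj : D.slices.length ≤ j) : D.level (j + 1) = [] := by
  simp [level, hj]

/-- The `i`-th point on the horizontal line below the first `j` slices. -/
def point (j i : ℕ) (h : i < (D.level j).length) : D.Point := ⟨(j, i), h⟩

/-- The colours on the horizontal line below the first `j` slices. -/
def levelColours (c : D.Point → X) (j : ℕ) : List X :=
  List.ofFn fun i : Fin (D.level j).length => c (D.point j i i.2)

/-- The colours on the horizontal lines below all slices. -/
def colourList (c : D.Point → X) : List (List X) :=
  (List.range D.slices.length).map fun j => D.levelColours c (j + 1)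

theorem length_levelColours (c : D.Point → X) (j : ℕ) :
    (D.levelColours c j).length = (D.level j).length := by simp [levelColours]

variable {D} in
theorem getElem_levelColours (c : D.Point → X) {x : D.Point} {j i : ℕ} (hx : x.1 = (j, i)) :
    (D.levelColours c j)[i]? = some (c x) := by
  obtain ⟨⟨j', i'⟩, h⟩ := x
  obtain ⟨rfl, rfl⟩ := Prod.mk.inj hx
  have hi : i' < (D.level j').length := h
  simp [levelColours, hi, point]

theorem getD_colourList (c : D.Point → X) (j : ℕ) :
    (D.colourList c).getD j [] = D.levelColours c (j + 1) := by
  rcases lt_or_ge j D.slices.length with h | h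
  · simp [colourList, h]
  · have e : (D.levelColours c (j + 1)).length = 0 := by
      rw [length_levelColours, D.level_succ_of_le h]; rfl
    rw [List.eq_nil_of_length_eq_zero e]
    simp [colourList, h]

theorem getD_cons_colourList (c : D.Point → X) (j : ℕ) :
    ([] :: D.colourList c).getD j [] = D.levelColours c j := by
  cases j with
  | zero => simp [levelColours, level]
  | succ j => simpa using D.getD_colourList c j

theorem colourList_injective : Function.Injective (D.colourList : (D.Point → X) → _) := by
  intro c c' h
  funext x
  have h₁ := getElem_levelColours c (x := x) rfl
  rw [← getD_cons_colourList, h, getD_cons_colourList, getElem_levelColours c' (x := x) rfl] at h₁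
  exact (Option.some.inj h₁).symm

theorem mapLists_colourList [Singquandle X] [Singquandle Y] (f : SQHom X Y) (c : D.Point → X) :
    f.mapLists (D.colourList c) = D.colourList fun x => f.toFun (c x) := by
  simp [SQHom.mapLists, colourList, levelColours, List.map_ofFn, Function.comp_def]

/-- A function on the points of a diagram is a colouring if it is constant on the arcs and the
relations at all crossings hold. -/
def IsColouring [Singquandle X] (c : D.Point → X) : Prop :=
  (∀ x y, D.Joined x y → c x = c y) ∧
  ∀ (j i : ℕ) (k : CrossingKind) (d e : Dir) (p q r s : D.Point),
    D.HasPiece j (.cross k d e) i →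
    p.1 = (j, i) → q.1 = (j, i + 1) → r.1 = (j + 1, i) → s.1 = (j + 1, i + 1) →
    ∀ u v, CrossingRel (c p) (c q) (c r) (c s) k d e u v → u = v

variable {D}

theorem getElem?_append_add {α : Type*} (l l' : List α) (i : ℕ) :
    (l ++ l')[l.length + i]? = l'[i]? := by
  rw [List.getElem?_append_right (by omega)]
  congr 1
  omega

section

variable [Singquandle X] {c : D.Point → X}

theorem isColouring_of_sliceColouring
    (h : ∀ j s, D.slices[j]? = some s →
      SliceColouring s (D.levelColours c j) (D.levelColours c (j + 1))) : D.IsColouring c := by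
  -- Colours on two consecutive lines, split at the piece between them.
  have split : ∀ j g i, D.HasPiece j g i → ∃ cl ct cb cr : List X, cl.length = i ∧
      D.levelColours c j = cl ++ (ct ++ cr) ∧ D.levelColours c (j + 1) = cl ++ (cb ++ cr) ∧
      PieceColouring g ct cb := by
    rintro j g i ⟨s, hj, rfl, rfl⟩
    obtain ⟨cl, ct, cb, cr, hl, -, h₁, h₂, hp⟩ := h j s hj
    exact ⟨cl, ct, cb, cr, hl, h₁, h₂, hp⟩
  have value : ∀ (x : D.Point) (j i : ℕ) (cl l : List X), x.1 = (j, cl.length + i) →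
      D.levelColours c j = cl ++ l → l[i]? = some (c x) := by
    intro x j i cl l hx hl
    rw [← getElem_levelColours c hx, hl, getElem?_append_add]
  constructor
  · intro x y hxy
    cases hxy with
    | @left j i i' g hg hi _ _ hx hy =>
      obtain ⟨cl, ct, cb, cr, rfl, h₁, h₂, hp⟩ := split j g i hg
      have ex := getElem_levelColours c hx
      have ey := getElem_levelColours c hy
      rw [h₁, List.getElem?_append_left hi] at ex
      rw [h₂, List.getElem?_append_left hi] at ey
      exact Option.some.inj (ex.symm.trans ey)
    | @right j i i' g hg _ _ hx hy =>
      obtain ⟨cl, ct, cb, cr, rfl, h₁, h₂, hp⟩ := split j g i hg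
      rw [← hp.length_top, ← List.length_append] at hx
      rw [← hp.length_bot, ← List.length_append] at hy
      rw [← List.append_assoc] at h₁ h₂
      exact Option.some.inj ((value x j i' _ _ hx h₁).symm.trans (value y (j + 1) i' _ _ hy h₂))
    | @maximum j i d hg _ _ hx hy =>
      obtain ⟨cl, ct, cb, cr, rfl, h₁, h₂, -, z, rfl⟩ := split j _ i hg
      exact (Option.some.inj (value x _ 0 _ _ hx h₂)).symm.trans
        (Option.some.inj (value y _ 1 _ _ hy h₂))
    | @minimum j i d hg _ _ hx hy =>
      obtain ⟨cl, ct, cb, cr, rfl, h₁, h₂, ⟨z, rfl⟩, -⟩ := split j _ i hg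
      exact (Option.some.inj (value x _ 0 _ _ hx h₁)).symm.trans
        (Option.some.inj (value y _ 1 _ _ hy h₁))
    | @overRL j i d e hg _ _ hx hy =>
      obtain ⟨cl, ct, cb, cr, rfl, h₁, h₂, p, q, r, s, rfl, rfl, rfl, -⟩ := split j _ i hg
      exact (Option.some.inj (value x _ 1 _ _ hx h₁)).symm.trans
        (Option.some.inj (value y _ 0 _ _ hy h₂))
    | @overLR j i d e hg _ _ hx hy =>
      obtain ⟨cl, ct, cb, cr, rfl, h₁, h₂, p, q, r, s, rfl, rfl, -, rfl⟩ := split j _ i hg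
      exact (Option.some.inj (value x _ 0 _ _ hx h₁)).symm.trans
        (Option.some.inj (value y _ 1 _ _ hy h₂))
  · intro j i k d e p q r s hg hp hq hr hs
    obtain ⟨cl, ct, cb, cr, rfl, h₁, h₂, p', q', r', s', rfl, rfl, hc⟩ := split j _ i hg
    obtain rfl := Option.some.inj (value p _ 0 _ _ hp h₁)
    obtain rfl := Option.some.inj (value q _ 1 _ _ hq h₁)
    obtain rfl := Option.some.inj (value r _ 0 _ _ hr h₂)
    obtain rfl := Option.some.inj (value s _ 1 _ _ hs h₂)
    exact (crossingColouring_iff.1 hc).2.2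

theorem IsColouring.sliceColouring (h : D.IsColouring c) {j : ℕ} {s : Slice}
    (hj : D.slices[j]? = some s) :
    SliceColouring s (D.levelColours c j) (D.levelColours c (j + 1)) := by
  obtain ⟨left, g, right⟩ := s
  have hg : D.HasPiece j g left.length := ⟨_, hj, rfl, rfl⟩
  have split : ∀ (L : List X) (m : ℕ), L.length = left.length + m + right.length →
      ∃ cl cm cr : List X, L = cl ++ (cm ++ cr) ∧ cl.length = left.length ∧ cm.length = m ∧
        cr.length = right.length := by
    intro L m hL
    refine ⟨L.take left.length, (L.drop left.length).take m, (L.drop left.length).drop m,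
      by simp, ?_, ?_, ?_⟩ <;> simp <;> omega
  obtain ⟨cl, ct, cr, h₁, hl, ht, hr⟩ := split (D.levelColours c j) g.top.length (by
    rw [length_levelColours, D.level_of_getElem hj]
    simp [Slice.top]; omega)
  obtain ⟨cl', cb, cr', h₂, hl', hb, hr'⟩ := split (D.levelColours c (j + 1)) g.bot.length (by
    rw [length_levelColours, D.level_succ_of_getElem hj]
    simp [Slice.bot]; omega)
  have len₁ : (D.level j).length = left.length + (g.top.length + right.length) := by
    rw [← length_levelColours D c, h₁]; simp [hl, ht, hr]
  have len₂ : (D.level (j + 1)).length = left.length + (g.bot.length + right.length) := by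
    rw [← length_levelColours D c, h₂]; simp [hl', hb, hr']
  -- The colours at the points beside the piece.
  have top : ∀ i (hi : i < (D.level j).length),
      (cl ++ (ct ++ cr))[i]? = some (c (D.point j i hi)) := by
    intro i hi
    rw [← h₁, getElem_levelColours c (x := D.point _ i hi) rfl]
  have bot : ∀ i (hi : i < (D.level (j + 1)).length),
      (cl' ++ (cb ++ cr'))[i]? = some (c (D.point (j + 1) i hi)) := by
    intro i hi
    rw [← h₂, getElem_levelColours c (x := D.point _ i hi) rfl]
  obtain rfl : cl = cl' := by
    refine List.ext_getElem? fun i => ?_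
    rcases lt_or_ge i left.length with hi | hi
    · have e₁ := top i (by omega)
      have e₂ := bot i (by omega)
      rw [List.getElem?_append_left (by omega)] at e₁ e₂
      rw [e₁, e₂]
      exact congrArg some (h.1 _ _ (.left hg hi _ _ rfl rfl))
    · rw [List.getElem?_eq_none (by omega), List.getElem?_eq_none (by omega)]
  have top' : ∀ i (hi : left.length + i < (D.level j).length),
      (ct ++ cr)[i]? = some (c (D.point j (left.length + i) hi)) := by
    intro i hi
    rw [← top _ hi, ← hl, getElem?_append_add]
  have bot' : ∀ i (hi : left.length + i < (D.level (j + 1)).length),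
      (cb ++ cr')[i]? = some (c (D.point (j + 1) (left.length + i) hi)) := by
    intro i hi
    rw [← bot _ hi, ← hl, getElem?_append_add]
  obtain rfl : cr = cr' := by
    refine List.ext_getElem? fun i => ?_
    rcases lt_or_ge i right.length with hi | hi
    · rw [← getElem?_append_add ct cr, ← getElem?_append_add cb cr', ht, hb,
        top' (g.top.length + i) (by omega), bot' (g.bot.length + i) (by omega)]
      exact congrArg some (h.1 _ _ (.right (i' := i) hg _ _
        (by simp [point, add_assoc]) (by simp [point, add_assoc])))
    · rw [List.getElem?_eq_none (by omega), List.getElem?_eq_none (by omega)]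
  refine ⟨cl, ct, cb, cr, hl, hr, h₁, h₂, ?_⟩
  cases g with
  | maximum d =>
    simp only [Piece.bot, List.length_cons, List.length_nil] at hb len₂
    obtain ⟨x, y, rfl⟩ := List.length_eq_two.1 hb
    have ex := Option.some.inj (bot' 0 (by omega))
    have ey := Option.some.inj (bot' 1 (by omega))
    have exy : x = y := by rw [ex, ey]; exact h.1 _ _ (.maximum hg _ _ rfl rfl)
    exact ⟨List.length_eq_zero_iff.1 ht, x, by rw [exy]⟩
  | minimum d =>
    simp only [Piece.top, List.length_cons, List.length_nil] at ht len₁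
    obtain ⟨x, y, rfl⟩ := List.length_eq_two.1 ht
    have ex := Option.some.inj (top' 0 (by omega))
    have ey := Option.some.inj (top' 1 (by omega))
    have exy : x = y := by rw [ex, ey]; exact h.1 _ _ (.minimum hg _ _ rfl rfl)
    exact ⟨⟨x, by rw [exy]⟩, List.length_eq_zero_iff.1 hb⟩
  | cross k d e =>
    simp only [Piece.top, Piece.bot, List.length_cons, List.length_nil] at ht len₁ hb len₂
    obtain ⟨p, q, rfl⟩ := List.length_eq_two.1 ht
    obtain ⟨r, s, rfl⟩ := List.length_eq_two.1 hb
    have ep := Option.some.inj (top' 0 (by omega))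
    have eq := Option.some.inj (top' 1 (by omega))
    have er := Option.some.inj (bot' 0 (by omega))
    have es := Option.some.inj (bot' 1 (by omega))
    refine ⟨p, q, r, s, rfl, rfl, crossingColouring_iff.2 ⟨?_, ?_, ?_⟩⟩
    · rintro rfl
      rw [eq, er]
      exact h.1 _ _ (.overRL hg _ _ rfl rfl)
    · rintro rfl
      rw [ep, es]
      exact h.1 _ _ (.overLR hg _ _ rfl rfl)
    · rw [ep, eq, er, es]
      exact h.2 _ _ _ _ _ _ _ _ _ hg rfl rfl rfl rfl

theorem isColouring_iff : D.IsColouring c ↔ TangleColouring D.slices [] (D.colourList c) := by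
  rw [tangleColouring_iff_getElem]
  simp only [getD_cons_colourList, getD_colourList]
  constructor
  · exact fun h => ⟨by simp [colourList], fun j s hj => h.sliceColouring hj⟩
  · exact fun h => isColouring_of_sliceColouring h.2

theorem exists_colourList_eq {l : List (List X)} (h : TangleColouring D.slices [] l) :
    ∃ c : D.Point → X, D.colourList c = l := by
  obtain ⟨hlen, hs⟩ := tangleColouring_iff_getElem.1 h
  have len : ∀ j, (l.getD j []).length = (D.level (j + 1)).length := by
    intro j
    rcases lt_or_ge j D.slices.length with hj | hj
    · have e : D.slices[j]? = some D.slices[j] := List.getElem?_eq_getElem hj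
      rw [(hs j _ e).length_bot, D.level_succ_of_getElem e]
    · rw [D.level_succ_of_le hj, List.getD_eq_default _ _ (by omega)]
      rfl
  have ex : ∀ x : D.Point, ∃ a, (([] :: l).getD x.1.1 [])[x.1.2]? = some a := by
    rintro ⟨⟨_ | j, i⟩, hx⟩
    · exact absurd hx (Nat.not_lt_zero _)
    · have hi : i < (l.getD j []).length := by rw [len]; exact hx
      exact ⟨_, List.getElem?_eq_getElem hi⟩
  choose c hc using ex
  refine ⟨c, ?_⟩
  have level : ∀ j, D.levelColours c (j + 1) = l.getD j [] := by
    intro j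
    refine List.ext_getElem? fun i => ?_
    rcases lt_or_ge i (D.level (j + 1)).length with hi | hi
    · rw [getElem_levelColours c (x := D.point (j + 1) i hi) rfl]
      exact (hc (D.point (j + 1) i hi)).symm
    · rw [List.getElem?_eq_none (by rw [length_levelColours]; exact hi),
        List.getElem?_eq_none (by rw [len]; exact hi)]
  refine List.ext_getElem (by simp [colourList, hlen]) fun j h₁ h₂ => ?_
  rw [← List.getD_eq_getElem _ [] h₁, ← List.getD_eq_getElem _ [] h₂, getD_colourList, level]

end

variable (D) in
/-- The generator of the fundamental singquandle which belongs to the arc through a point. -/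
def arcElement (x : D.Point) : D.SQ := (PresentedSQ.mkHom D.ArcRel).toFun (D.arcGen x)

variable (D) in
theorem isColouring_arcElement : D.IsColouring D.arcElement := by
  constructor
  · intro x y h
    have e : D.arcGen x = D.arcGen y := congrArg FreeSQ.of (Quot.sound h)
    exact congrArg (PresentedSQ.mkHom D.ArcRel).toFun e
  · intro j i k d e p q r s hg hp hq hr hs u v huv
    obtain ⟨u, v, h, rfl, rfl⟩ := huv.exists_of_map (PresentedSQ.mkHom D.ArcRel)
    exact PresentedSQ.mkHom_eq ⟨j, i, k, d, e, p, q, r, s, hg, hp, hq, hr, hs, h⟩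

theorem IsColouring.existsUnique_hom [Singquandle X] {c : D.Point → X} (h : D.IsColouring c) :
    ∃! f : SQHom D.SQ X, ∀ x, f.toFun (D.arcElement x) = c x := by
  let f₀ : SQHom (FreeSQ D.Arc) X := FreeSQ.lift (Quot.lift c h.1)
  refine ⟨PresentedSQ.lift f₀ ?_, fun x => rfl, fun g hg => PresentedSQ.hom_ext ?_⟩
  · rintro u v ⟨j, i, k, d, e, p, q, r, s, hg, hp, hq, hr, hs, huv⟩
    exact h.2 j i k d e p q r s hg hp hq hr hs _ _ (huv.map f₀)
  · intro a
    induction a using Quot.inductionOn with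
    | h x => exact hg x

variable (D) in
/-- The fundamental singquandle of a diagram represents its colourings. -/
theorem isUniversal_SQ : IsUniversal (colourings D.slices) D.SQ (D.colourList D.arcElement) where
  mem := isColouring_iff.1 D.isColouring_arcElement
  existsUnique X _ l hl := by
    obtain ⟨c, rfl⟩ := exists_colourList_eq hl
    have key : ∀ f : SQHom D.SQ X, f.mapLists (D.colourList D.arcElement) = D.colourList c ↔
        ∀ x, f.toFun (D.arcElement x) = c x := by
      intro f
      rw [mapLists_colourList, D.colourList_injective.eq_iff, funext_iff]
    simpa only [key] using (isColouring_iff.2 hl).existsUnique_hom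

end LinkDiagram

/-! ### Local moves -/

section LocalMoves

variable {X : Type*} [Singquandle X]

/-- The boundary condition imposed by the tangle `w`: the colours `t` above it and `b` below it
extend to a colouring of the tangle. -/
def BoundaryColouring (w : List Slice) (t b : List X) : Prop :=
  ∃ l, TangleColouring w t l ∧ l.getLastD t = b

variable (X) in
/-- Colourings of the tangle `w` are determined by their boundary colours, provided that the upper
boundary has `N` points. -/
def BoundaryDetermines (N : ℕ) (w : List Slice) : Prop :=
  ∀ (t : List X) (l l' : List (List X)), t.length = N → TangleColouring w t l →
    TangleColouring w t l' → l.getLastD t = l'.getLastD t → l = l'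

theorem boundaryColouring_nil {t b : List X} : BoundaryColouring [] t b ↔ t = b := by
  constructor
  · rintro ⟨l, rfl, h⟩; exact h
  · rintro rfl; exact ⟨[], rfl, rfl⟩

theorem boundaryColouring_cons {s : Slice} {w : List Slice} {t b : List X} :
    BoundaryColouring (s :: w) t b ↔ ∃ c, SliceColouring s t c ∧ BoundaryColouring w c b := by
  constructor
  · rintro ⟨_ | ⟨c, l⟩, h, h'⟩
    · exact h.elim
    · exact ⟨c, h.1, l, h.2, by rwa [List.getLastD_cons] at h'⟩
  · rintro ⟨c, h, l, h', hb⟩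
    exact ⟨c :: l, ⟨h, h'⟩, by rwa [List.getLastD_cons]⟩

theorem boundaryDetermines_nil (N : ℕ) : BoundaryDetermines X N [] := by
  rintro t l l' - rfl rfl -
  rfl

/-- It suffices that the first line inside the tangle is determined by the boundary. -/
theorem boundaryDetermines_cons {N : ℕ} {s : Slice} {w : List Slice}
    (hs : ∀ t c c' b : List X, t.length = N → SliceColouring s t c → SliceColouring s t c' →
      BoundaryColouring w c b → BoundaryColouring w c' b → c = c')
    (hw : BoundaryDetermines X s.bot.length w) : BoundaryDetermines X N (s :: w) := by
  intro t l l' ht h h' hb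
  cases l with
  | nil => exact h.elim
  | cons c l =>
  cases l' with
  | nil => exact h'.elim
  | cons c' l' =>
  rw [List.getLastD_cons, List.getLastD_cons] at hb
  obtain rfl := hs t c c' _ ht h.1 h'.1 ⟨l, h.2, rfl⟩ ⟨l', h'.2, hb.symm⟩
  rw [hw c l l' h.1.length_bot h.2 h'.2 hb]

theorem boundaryDetermines_singleton (N : ℕ) (s : Slice) : BoundaryDetermines X N [s] :=
  boundaryDetermines_cons (fun _ c c' b _ _ _ h h' => by
    rw [boundaryColouring_nil] at h h'; exact h.trans h'.symm) (boundaryDetermines_nil _)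

theorem CrossingColouring.bot_unique {k : CrossingKind} (hk : k ≠ .sing) {d e : Dir}
    {p q r s r' s' : X} (h : CrossingColouring k d e p q r s)
    (h' : CrossingColouring k d e p q r' s') : r = r' ∧ s = s' := by
  cases k with
  | sing => exact absurd rfl hk
  | overRL => exact ⟨h.1.trans h'.1.symm, h.2.trans h'.2.symm⟩
  | overLR => exact ⟨h.1.trans h'.1.symm, h.2.trans h'.2.symm⟩

/-- Turning a classical crossing upside down gives the inverse crossing. -/
theorem crossingColouring_flip {k : CrossingKind} (hk : k ≠ .sing) {d e : Dir} {p q r s : X} :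
    CrossingColouring k d e p q r s ↔ CrossingColouring k.flip e d r s p q := by
  cases k with
  | sing => exact absurd rfl hk
  | overRL =>
    simp only [CrossingColouring, CrossingKind.flip]
    constructor
    · rintro ⟨rfl, rfl⟩; exact ⟨(signedStar_not_cancel _ _ _).symm, rfl⟩
    · rintro ⟨rfl, rfl⟩; exact ⟨rfl, (signedStar_cancel _ _ _).symm⟩
  | overLR =>
    simp only [CrossingColouring, CrossingKind.flip]
    constructor
    · rintro ⟨rfl, rfl⟩; exact ⟨rfl, (signedStar_cancel _ _ _).symm⟩
    · rintro ⟨rfl, rfl⟩; exact ⟨(signedStar_not_cancel _ _ _).symm, rfl⟩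

theorem CrossingKind.flip_ne_sing {k : CrossingKind} (hk : k ≠ .sing) : k.flip ≠ .sing := by
  cases k <;> simp_all [CrossingKind.flip]

theorem CrossingKind.flip_flip (k : CrossingKind) : k.flip.flip = k := by cases k <;> rfl

theorem CrossingColouring.top_unique {k : CrossingKind} (hk : k ≠ .sing) {d e : Dir}
    {p q r s p' q' : X} (h : CrossingColouring k d e p q r s)
    (h' : CrossingColouring k d e p' q' r s) : p = p' ∧ q = q' :=
  ((crossingColouring_flip hk).1 h).bot_unique (CrossingKind.flip_ne_sing hk)
    ((crossingColouring_flip hk).1 h')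

theorem exists_crossingColouring {k : CrossingKind} (hk : k ≠ .sing) (d e : Dir) (p q : X) :
    ∃ r s, CrossingColouring k d e p q r s := by
  cases k with
  | sing => exact absurd rfl hk
  | overRL => exact ⟨_, _, rfl, rfl⟩
  | overLR => exact ⟨_, _, rfl, rfl⟩

/-- Rotation of a crossing by a quarter turn. -/
theorem crossingColouring_rotate {k : CrossingKind} {d e : Dir} {p q r s : X} :
    CrossingColouring k e (!d) q r p s ↔ CrossingColouring k.flip d e p q s r := by
  cases k
  · simp only [CrossingColouring, CrossingKind.flip]
    constructor
    · rintro ⟨rfl, rfl⟩; exact ⟨rfl, rfl⟩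
    · rintro ⟨rfl, rfl⟩; exact ⟨rfl, rfl⟩
  · simp only [CrossingColouring, CrossingKind.flip]
    rw [and_comm, eq_signedStar_iff, Bool.not_not]
  · cases d <;> cases e <;> exact Iff.rfl

/-- A translation is an automorphism, so a strand can pass over a crossing. -/
theorem crossingColouring_signedStar (ε : Bool) (z : X) {k : CrossingKind} {d e : Dir}
    {p q r s : X} :
    CrossingColouring k d e (signedStar ε p z) (signedStar ε q z) (signedStar ε r z)
      (signedStar ε s z) ↔ CrossingColouring k d e p q r s := by
  cases k
  · simp only [CrossingColouring, ← signedStar_distrib, signedStar_inj]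
  · simp only [CrossingColouring, ← signedStar_distrib, signedStar_inj]
  · cases d <;> cases e <;>
      simp only [CrossingColouring, ← signedStar_opl, ← signedStar_opr, signedStar_inj]

theorem CrossingColouring.of_signedStar {ε : Bool} {z : X} {k : CrossingKind} {d e : Dir}
    {p q x y : X} (h : CrossingColouring k d e (signedStar ε p z) (signedStar ε q z) x y) :
    ∃ r s, x = signedStar ε r z ∧ y = signedStar ε s z ∧ CrossingColouring k d e p q r s := by
  refine ⟨signedStar (!ε) x z, signedStar (!ε) y z, (signedStar_cancel _ _ _).symm,
    (signedStar_cancel _ _ _).symm, (crossingColouring_signedStar ε z).1 ?_⟩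
  rwa [signedStar_cancel, signedStar_cancel]

/-- The two ways for a strand to pass under the two strands of a crossing agree. For a singular
crossing this is the mixed axiom of a singquandle. -/
theorem CrossingColouring.under {k : CrossingKind} {d e : Dir} {p q r s : X}
    (h : CrossingColouring k d e p q r s) (z : X) :
    signedStar e (signedStar d z p) q = signedStar d (signedStar e z r) s := by
  have star : ∀ p q z : X, signedStar true (signedStar true z p) q =
      signedStar true (signedStar true z (Singquandle.opl p q)) (Singquandle.opr p q) :=
    fun p q z => (Singquandle.star_star_eq p z q).symm
  cases k
  · obtain ⟨rfl, rfl⟩ := h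
    rw [signedStar_distrib e d]
  · obtain ⟨rfl, rfl⟩ := h
    rw [signedStar_distrib d e, signedStar_cancel]
  · cases d <;> cases e <;> obtain ⟨rfl, rfl⟩ := h
    · obtain ⟨y, rfl⟩ : ∃ y, z = signedStar true (signedStar true y s) r :=
        ⟨signedStar false (signedStar false z r) s, by
          rw [← Bool.not_true, signedStar_cancel, signedStar_cancel]⟩
      rw [← Bool.not_true, signedStar_not_cancel, signedStar_not_cancel, star,
        signedStar_not_cancel, signedStar_not_cancel]
    · obtain ⟨y, rfl⟩ : ∃ y, z = signedStar true y (Singquandle.opl q s) :=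
        ⟨signedStar false z (Singquandle.opl q s), by rw [← Bool.not_true, signedStar_cancel]⟩
      rw [← Bool.not_true, signedStar_not_cancel, ← star, signedStar_not_cancel]
    · obtain ⟨y, rfl⟩ : ∃ y, z = signedStar true y r :=
        ⟨signedStar false z r, by rw [← Bool.not_true, signedStar_cancel]⟩
      rw [← Bool.not_true, signedStar_not_cancel, star, signedStar_not_cancel]
    · exact star p q z

/-- A singular crossing below a classical one on the same two strands, and the reverse. -/
theorem singular_twist {d e : Dir} {p q r s : X} :
    CrossingColouring .sing e d q (signedStar e p q) r s ↔
      ∃ a, CrossingColouring .sing d e p q a r ∧ s = signedStar d a r := by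
  have twist : ∀ x y : X, Singquandle.opl y (x ⋆ y) = Singquandle.opr x y :=
    fun x y => (Singquandle.opr_eq x y).symm
  have twist' : ∀ x y : X, Singquandle.opr y (x ⋆ y) =
      Singquandle.opl x y ⋆ Singquandle.opr x y :=
    fun x y => (Singquandle.opl_star_opr x y).symm
  have cancel : ∀ x y : X, (x ⋆ y) ⋆⁻ y = x := fun x y => Rack.left_inv y x
  have cancel' : ∀ x y : X, (x ⋆⁻ y) ⋆ y = x := fun x y => Rack.right_inv y x
  cases d <;> cases e <;>
    simp only [CrossingColouring, signedStar, Bool.false_eq_true, if_true, if_false]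
  · constructor
    · rintro ⟨h, rfl⟩
      exact ⟨s ⋆ r, ⟨(twist _ _).symm, by rw [twist', ← h, cancel']⟩, (cancel _ _).symm⟩
    · rintro ⟨a, ⟨rfl, rfl⟩, rfl⟩
      obtain ⟨s, rfl⟩ : ∃ s, a = s ⋆ r := ⟨a ⋆⁻ r, (cancel' _ _).symm⟩
      rw [twist, twist', cancel, cancel]
      exact ⟨rfl, rfl⟩
  · constructor
    · rintro ⟨rfl, h⟩
      refine ⟨_, ⟨?_, rfl⟩, ?_⟩
      · rw [← twist] at h
        rw [← cancel p q, h, Singquandle.opl_bar, cancel, bar_eq_iff.2 Quandle.fix.symm]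
      · rw [← twist, Singquandle.opl_bar, cancel, bar_eq_iff.2 Quandle.fix.symm]
    · rintro ⟨a, ⟨rfl, rfl⟩, rfl⟩
      rw [← twist, ← twist, Singquandle.opl_bar, cancel, bar_eq_iff.2 Quandle.fix.symm,
        Singquandle.opl_star, Quandle.fix]
      exact ⟨rfl, rfl⟩
  · constructor
    · rintro ⟨h, h'⟩
      obtain ⟨t, rfl⟩ : ∃ t, p = t ⋆ q := ⟨p ⋆⁻ q, (cancel' _ _).symm⟩
      rw [cancel] at h h'
      have key : (t ⋆ q) ⋆ r = t ⋆ s := by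
        rw [h, h', Singquandle.star_star_eq, Quandle.fix]
      refine ⟨s ⋆⁻ r, ⟨?_, ?_⟩, (cancel' _ _).symm⟩
      · rw [← cancel (t ⋆ q) r, key, ← Singquandle.opl_bar, twist, ← h']
        exact (bar_eq_iff.2 Quandle.fix.symm).symm
      · rw [← cancel (t ⋆ q) r, key, ← Singquandle.opr_bar, twist', ← h', ← h, cancel]
    · rintro ⟨a, ⟨h, h'⟩, rfl⟩
      have key : (a ⋆ r) ⋆ q = a ⋆ p := by
        rw [h, h', Singquandle.star_star_eq, Quandle.fix]
      constructor
      · rw [← cancel (a ⋆ r) q, key, ← Singquandle.opl_bar, twist, ← h']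
        exact (bar_eq_iff.2 Quandle.fix.symm).symm
      · rw [← cancel (a ⋆ r) q, key, ← Singquandle.opr_bar, twist', ← h', ← h, cancel]
  · constructor
    · rintro ⟨rfl, rfl⟩
      exact ⟨_, ⟨rfl, twist _ _⟩, by rw [twist', twist]⟩
    · rintro ⟨a, ⟨rfl, rfl⟩, rfl⟩
      exact ⟨(twist _ _).symm, (twist' _ _).symm⟩

/-- The algebraic content of the fifth Reidemeister move. -/
theorem exists_crossing_singular_iff {k : CrossingKind} (hk : k ≠ .sing) {d e : Dir}
    {p q x y : X} :
    (∃ r s, CrossingColouring k d e p q r s ∧ CrossingColouring .sing e d r s x y) ↔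
      ∃ r s, CrossingColouring .sing d e p q r s ∧ CrossingColouring k e d r s x y := by
  have overRL : ∀ {d e : Dir} {p q x y : X},
      (∃ r s, CrossingColouring .overRL d e p q r s ∧ CrossingColouring .sing e d r s x y) ↔
      ∃ r s, CrossingColouring .sing d e p q r s ∧ CrossingColouring .overRL e d r s x y := by
    intro d e p q x y
    constructor
    · rintro ⟨r, s, ⟨rfl, rfl⟩, h⟩
      obtain ⟨a, h', rfl⟩ := singular_twist.1 h
      exact ⟨_, _, h', rfl, rfl⟩
    · rintro ⟨r, s, h, rfl, rfl⟩
      exact ⟨_, _, ⟨rfl, rfl⟩, singular_twist.2 ⟨_, h, rfl⟩⟩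
  cases k with
  | sing => exact absurd rfl hk
  | overRL => exact overRL
  | overLR =>
    -- The equation for the inverse crossing: compose with the inverses on both sides.
    have flip : ∀ {d e : Dir} {p q r s : X}, CrossingColouring .overLR d e p q r s ↔
      CrossingColouring .overRL e d r s p q := crossingColouring_flip (by simp)
    constructor
    · rintro ⟨r, s, h, h'⟩
      obtain ⟨u, v, hu⟩ := exists_crossingColouring (k := .overRL) (by simp) d e x y
      obtain ⟨a, b, h1, h2⟩ := overRL.2 ⟨x, y, h', hu⟩
      obtain ⟨rfl, rfl⟩ := h1.bot_unique (by simp) (flip.1 h)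
      exact ⟨u, v, h2, flip.2 hu⟩
    · rintro ⟨u, v, h, h'⟩
      obtain ⟨r, s, hr⟩ := exists_crossingColouring (k := .overLR) (by simp) d e p q
      obtain ⟨a, b, h1, h2⟩ := overRL.1 ⟨p, q, flip.1 hr, h⟩
      obtain ⟨rfl, rfl⟩ := h2.top_unique (by simp) (flip.1 h')
      exact ⟨r, s, hr, h1⟩

/-- The crossing in the slice is classical, so the colours on either of the two lines beside it
determine those on the other. -/
def Slice.IsClassical (s : Slice) : Prop := ∃ k d e, k ≠ CrossingKind.sing ∧ s.piece = .cross k d e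

theorem SliceColouring.bot_unique {s : Slice} (hs : s.IsClassical) {t b b' : List X}
    (h : SliceColouring s t b) (h' : SliceColouring s t b') : b = b' := by
  obtain ⟨left, g, right⟩ := s
  obtain ⟨k, d, e, hk, hg⟩ := hs
  obtain rfl : g = .cross k d e := hg
  obtain ⟨cl, ct, cb, cr, hl, hr, rfl, rfl, hp⟩ := h
  obtain ⟨cb', rfl, hp'⟩ := (sliceColouring_iff hl hp.length_top hr).1 h'
  obtain ⟨p, q, r, s, rfl, rfl, hc⟩ := hp
  obtain ⟨_, _, r', s', ⟨⟩, rfl, hc'⟩ := hp'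
  obtain ⟨rfl, rfl⟩ := hc.bot_unique hk hc'
  rfl

theorem SliceColouring.top_unique {s : Slice} (hs : s.IsClassical) {t t' b : List X}
    (h : SliceColouring s t b) (h' : SliceColouring s t' b) : t = t' := by
  obtain ⟨left, g, right⟩ := s
  obtain ⟨k, d, e, hk, hg⟩ := hs
  obtain rfl : g = .cross k d e := hg
  obtain ⟨cl, ct, cb, cr, hl, hr, rfl, rfl, p, q, r, s, rfl, rfl, hc⟩ := h
  obtain ⟨cl', ct', cb', cr', hl', hr', rfl, hb, p', q', r', s', rfl, rfl, hc'⟩ := h'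
  obtain ⟨rfl, hb₁⟩ := List.append_inj hb (hl.trans hl'.symm)
  obtain ⟨hb₂, rfl⟩ := List.append_inj hb₁ rfl
  obtain ⟨rfl, rfl⟩ : r = r' ∧ s = s' := by simpa using hb₂
  obtain ⟨rfl, rfl⟩ := hc.top_unique hk hc'
  rfl

theorem BoundaryColouring.top_unique {w : List Slice} (hw : ∀ s ∈ w, s.IsClassical)
    {t t' b : List X} (h : BoundaryColouring w t b) (h' : BoundaryColouring w t' b) : t = t' := by
  induction w generalizing t t' with
  | nil =>
    rw [boundaryColouring_nil] at h h'
    exact h.trans h'.symm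
  | cons s w ih =>
    obtain ⟨c, hc, h⟩ := boundaryColouring_cons.1 h
    obtain ⟨c', hc', h'⟩ := boundaryColouring_cons.1 h'
    obtain rfl := ih (fun s hs => hw s (List.mem_cons_of_mem _ hs)) h h'
    exact hc.top_unique (hw s List.mem_cons_self) hc'

theorem boundaryDetermines_cons_classical {N : ℕ} {s : Slice} {w : List Slice}
    (hs : s.IsClassical) (hw : BoundaryDetermines X s.bot.length w) :
    BoundaryDetermines X N (s :: w) :=
  boundaryDetermines_cons (fun _ _ _ _ _ h h' _ _ => h.bot_unique hs h') hw

/-- If all slices below the first one are classical, then the colours are determined upwards from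
the lower boundary. -/
theorem boundaryDetermines_cons_of_classical {N : ℕ} {s : Slice} {w : List Slice}
    (hw : ∀ s ∈ w, s.IsClassical) : BoundaryDetermines X N (s :: w) := by
  have all : ∀ (w : List Slice), (∀ s ∈ w, s.IsClassical) → ∀ N, BoundaryDetermines X N w := by
    intro w
    induction w with
    | nil => exact fun _ => boundaryDetermines_nil
    | cons s w ih =>
      intro h N
      exact boundaryDetermines_cons_classical (h s List.mem_cons_self)
        (ih (fun s hs => h s (List.mem_cons_of_mem _ hs)) _)
  exact boundaryDetermines_cons (fun _ _ _ _ _ _ _ h h' => h.top_unique hw h') (all w hw _)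

section Cons

variable {k : CrossingKind} {d e x : Dir} {w : List Slice} {p q z : X} {b : List X}

/-- The boundary condition of a tangle in terms of the piece in its first slice, for upper boundary
colours which are split according to that slice. -/
theorem boundaryColouring_cons_iff {left right : List Dir} {g : Piece} (cl ct cr : List X)
    (hl : cl.length = left.length) (ht : ct.length = g.top.length)
    (hr : cr.length = right.length) :
    BoundaryColouring (⟨left, g, right⟩ :: w) (cl ++ (ct ++ cr)) b ↔
      ∃ cb, PieceColouring g ct cb ∧ BoundaryColouring w (cl ++ (cb ++ cr)) b := by
  rw [boundaryColouring_cons]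
  constructor
  · rintro ⟨c, h, h'⟩
    obtain ⟨cb, rfl, hp⟩ := (sliceColouring_iff hl ht hr).1 h
    exact ⟨cb, hp, h'⟩
  · rintro ⟨cb, h, h'⟩
    exact ⟨_, (sliceColouring_iff hl ht hr).2 ⟨cb, rfl, h⟩, h'⟩

theorem exists_pieceColouring_cross {P : List X → Prop} :
    (∃ cb, PieceColouring (.cross k d e) [p, q] cb ∧ P cb) ↔
      ∃ r s, CrossingColouring k d e p q r s ∧ P [r, s] := by
  constructor
  · rintro ⟨_, ⟨_, _, r, s, ⟨⟩, rfl, h⟩, h'⟩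
    exact ⟨r, s, h, h'⟩
  · rintro ⟨r, s, h, h'⟩
    exact ⟨_, ⟨_, _, r, s, rfl, rfl, h⟩, h'⟩

theorem exists_pieceColouring_maximum {P : List X → Prop} :
    (∃ cb, PieceColouring (.maximum d) [] cb ∧ P cb) ↔ ∃ y, P [y, y] := by
  constructor
  · rintro ⟨_, ⟨-, y, rfl⟩, h⟩
    exact ⟨y, h⟩
  · rintro ⟨y, h⟩
    exact ⟨_, ⟨rfl, y, rfl⟩, h⟩

theorem exists_pieceColouring_minimum {P : List X → Prop} :
    (∃ cb, PieceColouring (.minimum d) [p, q] cb ∧ P cb) ↔ p = q ∧ P [] := by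
  constructor
  · rintro ⟨_, ⟨⟨y, ⟨⟩⟩, rfl⟩, h⟩
    exact ⟨rfl, h⟩
  · rintro ⟨rfl, h⟩
    exact ⟨_, ⟨⟨p, rfl⟩, rfl⟩, h⟩

theorem boundaryColouring_cross :
    BoundaryColouring (⟨[], .cross k d e, []⟩ :: w) [p, q] b ↔
      ∃ r s, CrossingColouring k d e p q r s ∧ BoundaryColouring w [r, s] b :=
  (boundaryColouring_cons_iff [] [p, q] [] rfl rfl rfl).trans exists_pieceColouring_cross

theorem boundaryColouring_left_cross :
    BoundaryColouring (⟨[x], .cross k d e, []⟩ :: w) [z, p, q] b ↔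
      ∃ r s, CrossingColouring k d e p q r s ∧ BoundaryColouring w [z, r, s] b :=
  (boundaryColouring_cons_iff [z] [p, q] [] rfl rfl rfl).trans exists_pieceColouring_cross

theorem boundaryColouring_cross_right :
    BoundaryColouring (⟨[], .cross k d e, [x]⟩ :: w) [p, q, z] b ↔
      ∃ r s, CrossingColouring k d e p q r s ∧ BoundaryColouring w [r, s, z] b :=
  (boundaryColouring_cons_iff [] [p, q] [z] rfl rfl rfl).trans exists_pieceColouring_cross

theorem boundaryColouring_maximum :
    BoundaryColouring (⟨[], .maximum d, []⟩ :: w) [] b ↔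
      ∃ y : X, BoundaryColouring w [y, y] b :=
  (boundaryColouring_cons_iff (X := X) [] [] [] rfl rfl rfl).trans exists_pieceColouring_maximum

theorem boundaryColouring_left_maximum :
    BoundaryColouring (⟨[x], .maximum d, []⟩ :: w) [z] b ↔
      ∃ y : X, BoundaryColouring w [z, y, y] b :=
  (boundaryColouring_cons_iff [z] [] [] rfl rfl rfl).trans exists_pieceColouring_maximum

theorem boundaryColouring_maximum_right :
    BoundaryColouring (⟨[], .maximum d, [x]⟩ :: w) [z] b ↔
      ∃ y : X, BoundaryColouring w [y, y, z] b :=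
  (boundaryColouring_cons_iff [] [] [z] rfl rfl rfl).trans exists_pieceColouring_maximum

theorem boundaryColouring_minimum :
    BoundaryColouring (⟨[], .minimum d, []⟩ :: w) [p, q] b ↔ p = q ∧ BoundaryColouring w [] b :=
  (boundaryColouring_cons_iff [] [p, q] [] rfl rfl rfl).trans exists_pieceColouring_minimum

theorem boundaryColouring_left_minimum :
    BoundaryColouring (⟨[x], .minimum d, []⟩ :: w) [z, p, q] b ↔
      p = q ∧ BoundaryColouring w [z] b :=
  (boundaryColouring_cons_iff [z] [p, q] [] rfl rfl rfl).trans exists_pieceColouring_minimum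

theorem boundaryColouring_minimum_right :
    BoundaryColouring (⟨[], .minimum d, [x]⟩ :: w) [p, q, z] b ↔
      p = q ∧ BoundaryColouring w [z] b :=
  (boundaryColouring_cons_iff [] [p, q] [z] rfl rfl rfl).trans exists_pieceColouring_minimum

end Cons

/-- Uniqueness for a slice above one further slice, in terms of its piece. -/
theorem boundaryDetermines_pair {N : ℕ} {left right : List Dir} {g : Piece} {s : Slice}
    (hs : ∀ cl ct cr cb cb' b : List X, (cl ++ (ct ++ cr)).length = N →
      cl.length = left.length → cr.length = right.length →
      PieceColouring g ct cb → PieceColouring g ct cb' →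
      BoundaryColouring [s] (cl ++ (cb ++ cr)) b → BoundaryColouring [s] (cl ++ (cb' ++ cr)) b →
      cb = cb') : BoundaryDetermines X N [⟨left, g, right⟩, s] := by
  refine boundaryDetermines_cons ?_ (boundaryDetermines_singleton _ _)
  rintro t c c' b hN h h' hb hb'
  obtain ⟨cl, ct, cb, cr, hl, hr, rfl, rfl, hp⟩ := h
  obtain ⟨cb', rfl, hp'⟩ := (sliceColouring_iff hl hp.length_top hr).1 h'
  rw [hs cl ct cr cb cb' b hN hl hr hp hp' hb hb']

variable (X) in
/-- Two tangles with `N` upper ends impose the same conditions on the colours of their boundary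
points, and these colours determine all others. -/
structure ColourEquivalent (N : ℕ) (w w' : List Slice) : Prop where
  unique : BoundaryDetermines X N w
  unique' : BoundaryDetermines X N w'
  boundary : ∀ t b : List X, t.length = N → (BoundaryColouring w t b ↔ BoundaryColouring w' t b)

theorem colourEquivalent_exchange (g h : Piece) (m : List Dir) :
    ColourEquivalent X (g.top ++ m ++ h.top).length
      [⟨[], g, m ++ h.top⟩, ⟨g.bot ++ m, h, []⟩] [⟨g.top ++ m, h, []⟩, ⟨[], g, m ++ h.bot⟩] := by
  have split : ∀ t : List X, t.length = (g.top ++ m ++ h.top).length → ∃ cg cm ch : List X,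
      t = cg ++ (cm ++ ch) ∧ cg.length = g.top.length ∧ cm.length = m.length ∧
        ch.length = h.top.length := by
    intro t ht
    simp only [List.length_append] at ht
    refine ⟨t.take g.top.length, (t.drop g.top.length).take m.length,
      (t.drop g.top.length).drop m.length, by simp, ?_, ?_, ?_⟩ <;> simp <;> omega
  -- In either order the boundary conditions of the two pieces are imposed independently.
  have gh : ∀ (cg cm ch b : List X), cg.length = g.top.length → cm.length = m.length →
      ch.length = h.top.length →
      (BoundaryColouring [⟨[], g, m ++ h.top⟩, ⟨g.bot ++ m, h, []⟩] (cg ++ (cm ++ ch)) b ↔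
        ∃ bg bh, PieceColouring g cg bg ∧ PieceColouring h ch bh ∧ b = bg ++ (cm ++ bh)) := by
    intro cg cm ch b hg hm hh
    rw [← List.nil_append (cg ++ (cm ++ ch)),
      boundaryColouring_cons_iff [] cg (cm ++ ch) rfl hg (by simp [hm, hh])]
    refine exists_congr fun bg => ?_
    rw [exists_and_left]
    refine and_congr_right fun hbg => ?_
    have e : [] ++ (bg ++ (cm ++ ch)) = (bg ++ cm) ++ (ch ++ []) := by simp
    rw [e, boundaryColouring_cons_iff (bg ++ cm) ch [] (by simp [hm, hbg.length_bot]) hh rfl]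
    refine exists_congr fun bh => ?_
    rw [boundaryColouring_nil, eq_comm (a := b)]
    simp
  have hg : ∀ (cg cm ch b : List X), cg.length = g.top.length → cm.length = m.length →
      ch.length = h.top.length →
      (BoundaryColouring [⟨g.top ++ m, h, []⟩, ⟨[], g, m ++ h.bot⟩] (cg ++ (cm ++ ch)) b ↔
        ∃ bg bh, PieceColouring g cg bg ∧ PieceColouring h ch bh ∧ b = bg ++ (cm ++ bh)) := by
    intro cg cm ch b hg hm hh
    have e : cg ++ (cm ++ ch) = (cg ++ cm) ++ (ch ++ []) := by simp
    rw [e, boundaryColouring_cons_iff (cg ++ cm) ch [] (by simp [hm, hg]) hh rfl, exists_comm]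
    refine exists_congr fun bh => ?_
    have e : (cg ++ cm) ++ (bh ++ []) = [] ++ (cg ++ (cm ++ bh)) := by simp
    have key : PieceColouring h ch bh →
        (BoundaryColouring [⟨[], g, m ++ h.bot⟩] ((cg ++ cm) ++ (bh ++ [])) b ↔
          ∃ bg, PieceColouring g cg bg ∧ b = bg ++ (cm ++ bh)) := by
      intro hbh
      rw [e, boundaryColouring_cons_iff [] cg (cm ++ bh) rfl hg (by simp [hm, hbh.length_bot])]
      refine exists_congr fun bg => ?_
      rw [boundaryColouring_nil, eq_comm (a := b)]
      simp
    constructor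
    · rintro ⟨hbh, h'⟩
      obtain ⟨bg, h1, h2⟩ := (key hbh).1 h'
      exact ⟨bg, h1, hbh, h2⟩
    · rintro ⟨bg, h1, hbh, h2⟩
      exact ⟨hbh, (key hbh).2 ⟨bg, h1, h2⟩⟩
  refine ⟨?_, ?_, ?_⟩
  · refine boundaryDetermines_pair ?_
    rintro cl ct cr cb cb' b - hl hr hp hp' hb hb'
    obtain rfl : cl = [] := List.length_eq_zero_iff.1 hl
    -- The colours of the lower ends of `g` reappear on the lower boundary.
    have low : ∀ cb : List X, PieceColouring g ct cb →
        BoundaryColouring [⟨g.bot ++ m, h, []⟩] ([] ++ (cb ++ cr)) b →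
        b.take cb.length = cb := by
      intro cb hp hb
      have e : [] ++ (cb ++ cr) = (cb ++ cr.take m.length) ++ (cr.drop m.length ++ []) := by simp
      rw [e, boundaryColouring_cons_iff (cb ++ cr.take m.length) (cr.drop m.length) []
        (by simp [hp.length_bot, hr]) (by simp [hr]) rfl] at hb
      obtain ⟨bh, -, hb⟩ := hb
      rw [boundaryColouring_nil] at hb
      simp [← hb]
    rw [← low cb hp hb, ← low cb' hp' hb', hp.length_bot, hp'.length_bot]
  · refine boundaryDetermines_pair ?_
    rintro cl ct cr cb cb' b - hl hr hp hp' hb hb'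
    obtain rfl : cr = [] := List.length_eq_zero_iff.1 hr
    -- The colours of the lower ends of `h` reappear on the lower boundary.
    have low : ∀ cb : List X, PieceColouring h ct cb →
        BoundaryColouring [⟨[], g, m ++ h.bot⟩] (cl ++ (cb ++ [])) b →
        (b.drop g.bot.length).drop m.length = cb := by
      intro cb hp hb
      have e : cl ++ (cb ++ []) =
          [] ++ (cl.take g.top.length ++ (cl.drop g.top.length ++ cb)) := by
        simp [← List.append_assoc]
      rw [e, boundaryColouring_cons_iff [] (cl.take g.top.length) (cl.drop g.top.length ++ cb)
        rfl (by simp [hl]) (by simp [hp.length_bot, hl])] at hb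
      obtain ⟨bg, hbg, hb⟩ := hb
      rw [boundaryColouring_nil] at hb
      subst hb
      rw [List.nil_append, ← hbg.length_bot, List.drop_left]
      exact List.drop_left' (by simp [hl])
    rw [← low cb hp hb, ← low cb' hp' hb']
  · intro t b ht
    obtain ⟨cg, cm, ch, rfl, h1, h2, h3⟩ := split t ht
    rw [gh cg cm ch b h1 h2 h3, hg cg cm ch b h1 h2 h3]

theorem colourEquivalent_zigzag_left (d : Dir) :
    ColourEquivalent X 1 [⟨[d], .maximum (!d), []⟩, ⟨[], .minimum d, [d]⟩] [] := by
  refine ⟨?_, boundaryDetermines_nil _, ?_⟩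
  · refine boundaryDetermines_pair ?_
    rintro cl ct cr cb cb' b - hl hr ⟨rfl, x, rfl⟩ ⟨-, y, rfl⟩ hb hb'
    obtain ⟨z, rfl⟩ := List.length_eq_one_iff.1 hl
    obtain rfl : cr = [] := List.length_eq_zero_iff.1 hr
    rw [(boundaryColouring_minimum_right.1 hb).1.symm,
      (boundaryColouring_minimum_right.1 hb').1.symm]
  · intro t b ht
    obtain ⟨z, rfl⟩ := List.length_eq_one_iff.1 ht
    simp only [boundaryColouring_left_maximum, boundaryColouring_minimum_right,
      boundaryColouring_nil, exists_eq_left']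

theorem colourEquivalent_zigzag_right (d : Dir) :
    ColourEquivalent X 1 [⟨[], .maximum d, [d]⟩, ⟨[d], .minimum (!d), []⟩] [] := by
  refine ⟨?_, boundaryDetermines_nil _, ?_⟩
  · refine boundaryDetermines_pair ?_
    rintro cl ct cr cb cb' b - hl hr ⟨rfl, x, rfl⟩ ⟨-, y, rfl⟩ hb hb'
    obtain ⟨z, rfl⟩ := List.length_eq_one_iff.1 hr
    obtain rfl : cl = [] := List.length_eq_zero_iff.1 hl
    rw [(boundaryColouring_left_minimum.1 hb).1, (boundaryColouring_left_minimum.1 hb').1]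
  · intro t b ht
    obtain ⟨z, rfl⟩ := List.length_eq_one_iff.1 ht
    simp only [boundaryColouring_maximum_right, boundaryColouring_left_minimum,
      boundaryColouring_nil, exists_eq_left]

theorem colourEquivalent_slide_minimum (k : CrossingKind) (d e : Dir) :
    ColourEquivalent X 3 [⟨[d], .cross k e (!d), []⟩, ⟨[], .minimum d, [e]⟩]
      [⟨[], .cross k.flip d e, [!d]⟩, ⟨[e], .minimum d, []⟩] := by
  refine ⟨?_, ?_, ?_⟩
  · refine boundaryDetermines_pair ?_
    rintro cl ct cr cb cb' b - hl hr ⟨_, _, r, s, rfl, rfl, -⟩ ⟨_, _, r', s', -, rfl, -⟩ hb hb'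
    obtain ⟨z, rfl⟩ := List.length_eq_one_iff.1 hl
    obtain rfl : cr = [] := List.length_eq_zero_iff.1 hr
    obtain ⟨rfl, h⟩ := boundaryColouring_minimum_right.1 hb
    obtain ⟨rfl, h'⟩ := boundaryColouring_minimum_right.1 hb'
    rw [boundaryColouring_nil] at h h'
    rw [List.singleton_inj.1 (h.trans h'.symm)]
  · refine boundaryDetermines_pair ?_
    rintro cl ct cr cb cb' b - hl hr ⟨_, _, r, s, rfl, rfl, -⟩ ⟨_, _, r', s', -, rfl, -⟩ hb hb'
    obtain ⟨z, rfl⟩ := List.length_eq_one_iff.1 hr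
    obtain rfl : cl = [] := List.length_eq_zero_iff.1 hl
    obtain ⟨rfl, h⟩ := boundaryColouring_left_minimum.1 hb
    obtain ⟨rfl, h'⟩ := boundaryColouring_left_minimum.1 hb'
    rw [boundaryColouring_nil] at h h'
    rw [List.singleton_inj.1 (h.trans h'.symm)]
  · intro t b ht
    obtain ⟨p, q, r, rfl⟩ := List.length_eq_three.1 ht
    simp only [boundaryColouring_left_cross, boundaryColouring_cross_right,
      boundaryColouring_left_minimum, boundaryColouring_minimum_right, boundaryColouring_nil]
    constructor
    · rintro ⟨_, s, h, rfl, rfl⟩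
      exact ⟨s, r, crossingColouring_rotate.1 h, rfl, rfl⟩
    · rintro ⟨s, _, h, rfl, rfl⟩
      exact ⟨p, s, crossingColouring_rotate.2 h, rfl, rfl⟩

theorem colourEquivalent_slide_maximum (k : CrossingKind) (d e : Dir) :
    ColourEquivalent X 1 [⟨[], .maximum d, [e]⟩, ⟨[d], .cross k (!d) e, []⟩]
      [⟨[e], .maximum d, []⟩, ⟨[], .cross k.flip e d, [!d]⟩] := by
  refine ⟨?_, ?_, ?_⟩
  · refine boundaryDetermines_pair ?_
    rintro cl ct cr cb cb' b - hl hr ⟨rfl, x, rfl⟩ ⟨-, y, rfl⟩ hb hb'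
    obtain ⟨z, rfl⟩ := List.length_eq_one_iff.1 hr
    obtain rfl : cl = [] := List.length_eq_zero_iff.1 hl
    obtain ⟨r, s, -, hb⟩ := boundaryColouring_left_cross.1 hb
    obtain ⟨r', s', -, hb'⟩ := boundaryColouring_left_cross.1 hb'
    rw [boundaryColouring_nil] at hb hb'
    rw [(List.cons_eq_cons.1 (hb.trans hb'.symm)).1]
  · refine boundaryDetermines_pair ?_
    rintro cl ct cr cb cb' b - hl hr ⟨rfl, x, rfl⟩ ⟨-, y, rfl⟩ hb hb'
    obtain ⟨z, rfl⟩ := List.length_eq_one_iff.1 hl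
    obtain rfl : cr = [] := List.length_eq_zero_iff.1 hr
    obtain ⟨r, s, -, hb⟩ := boundaryColouring_cross_right.1 hb
    obtain ⟨r', s', -, hb'⟩ := boundaryColouring_cross_right.1 hb'
    rw [boundaryColouring_nil] at hb hb'
    obtain ⟨-, -, rfl⟩ : r = r' ∧ s = s' ∧ x = y := by simpa using hb.trans hb'.symm
    rfl
  · intro t b ht
    obtain ⟨z, rfl⟩ := List.length_eq_one_iff.1 ht
    simp only [boundaryColouring_left_cross, boundaryColouring_cross_right,
      boundaryColouring_left_maximum, boundaryColouring_maximum_right, boundaryColouring_nil]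
    have rotate : ∀ x r s : X, CrossingColouring k (!d) e x z r s ↔
        CrossingColouring k.flip e d z s x r := by
      intro x r s
      have h := crossingColouring_rotate (k := k.flip) (d := !d) (e := e) (p := x) (q := z)
        (r := s) (s := r)
      rw [Bool.not_not, CrossingKind.flip_flip] at h
      exact h.symm
    constructor
    · rintro ⟨x, r, s, h, rfl⟩
      exact ⟨s, x, r, (rotate x r s).1 h, rfl⟩
    · rintro ⟨s, x, r, h, rfl⟩
      exact ⟨x, r, s, (rotate x r s).2 h, rfl⟩

theorem colourEquivalent_reidemeister1_maximum {k : CrossingKind} (hk : k ≠ .sing) (d : Dir) :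
    ColourEquivalent X 0 [⟨[], .maximum d, []⟩, ⟨[], .cross k d (!d), []⟩]
      [⟨[], .maximum (!d), []⟩] := by
  refine ⟨boundaryDetermines_cons_of_classical ?_, boundaryDetermines_singleton _ _, ?_⟩
  · simpa using ⟨k, d, !d, hk, rfl⟩
  · intro t b ht
    obtain rfl : t = [] := List.length_eq_zero_iff.1 ht
    simp only [boundaryColouring_maximum, boundaryColouring_cross, boundaryColouring_nil]
    refine exists_congr fun y => ?_
    cases k with
    | sing => exact absurd rfl hk
    | overRL => simp [CrossingColouring, signedStar_self]
    | overLR => simp [CrossingColouring, signedStar_self]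

theorem colourEquivalent_reidemeister1_minimum {k : CrossingKind} (hk : k ≠ .sing) (d : Dir) :
    ColourEquivalent X 2 [⟨[], .cross k d (!d), []⟩, ⟨[], .minimum (!d), []⟩]
      [⟨[], .minimum d, []⟩] := by
  refine ⟨boundaryDetermines_cons_classical ⟨k, d, !d, hk, rfl⟩ (boundaryDetermines_singleton _ _),
    boundaryDetermines_singleton _ _, ?_⟩
  intro t b ht
  obtain ⟨p, q, rfl⟩ := List.length_eq_two.1 ht
  simp only [boundaryColouring_minimum, boundaryColouring_cross, boundaryColouring_nil]
  have fixed : ∀ (ε : Bool) (x y : X), x = signedStar ε y x ↔ y = x := by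
    intro ε x y
    rw [eq_signedStar_iff, signedStar_self]
  cases k with
  | sing => exact absurd rfl hk
  | overRL =>
    constructor
    · rintro ⟨r, s, ⟨rfl, h⟩, rfl, hb⟩
      exact ⟨(fixed _ _ _).1 h, hb⟩
    · rintro ⟨rfl, hb⟩
      exact ⟨p, p, ⟨rfl, (signedStar_self _ _).symm⟩, rfl, hb⟩
  | overLR =>
    constructor
    · rintro ⟨r, s, ⟨h, rfl⟩, rfl, hb⟩
      exact ⟨((fixed _ _ _).1 h).symm, hb⟩
    · rintro ⟨rfl, hb⟩
      exact ⟨p, p, ⟨(signedStar_self _ _).symm, rfl⟩, rfl, hb⟩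

theorem colourEquivalent_reidemeister2 {k : CrossingKind} (hk : k ≠ .sing) (d e : Dir) :
    ColourEquivalent X 2 [⟨[], .cross k d e, []⟩, ⟨[], .cross k.flip e d, []⟩] [] := by
  refine ⟨boundaryDetermines_cons_classical ⟨k, d, e, hk, rfl⟩ (boundaryDetermines_singleton _ _),
    boundaryDetermines_nil _, ?_⟩
  intro t b ht
  obtain ⟨p, q, rfl⟩ := List.length_eq_two.1 ht
  simp only [boundaryColouring_cross, boundaryColouring_nil]
  constructor
  · rintro ⟨r, s, h, p', q', h', rfl⟩
    obtain ⟨rfl, rfl⟩ :=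
      h'.bot_unique (CrossingKind.flip_ne_sing hk) ((crossingColouring_flip hk).1 h)
    rfl
  · rintro rfl
    obtain ⟨r, s, h⟩ := exists_crossingColouring hk d e p q
    exact ⟨r, s, h, p, q, (crossingColouring_flip hk).1 h, rfl⟩

theorem colourEquivalent_pass_left {k : CrossingKind} (k' : CrossingKind) (hk : k ≠ .sing)
    (d e f : Dir) :
    ColourEquivalent X 3
      [⟨[], .cross k d e, [f]⟩, ⟨[e], .cross k d f, []⟩, ⟨[], .cross k' e f, [d]⟩]
      [⟨[d], .cross k' e f, []⟩, ⟨[], .cross k d f, [e]⟩, ⟨[f], .cross k d e, []⟩] := by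
  refine ⟨boundaryDetermines_cons_classical ⟨k, d, e, hk, rfl⟩
    (boundaryDetermines_cons_classical ⟨k, d, f, hk, rfl⟩ (boundaryDetermines_singleton _ _)),
    boundaryDetermines_cons_of_classical ?_, ?_⟩
  · simpa using ⟨⟨k, d, f, hk, rfl⟩, ⟨k, d, e, hk, rfl⟩⟩
  · intro t b ht
    obtain ⟨p, q, r, rfl⟩ := List.length_eq_three.1 ht
    simp only [boundaryColouring_left_cross, boundaryColouring_cross_right, boundaryColouring_nil]
    cases k with
    | sing => exact absurd rfl hk
    | overRL =>
      constructor
      · rintro ⟨_, _, ⟨rfl, rfl⟩, _, _, ⟨rfl, rfl⟩, x, y, h, rfl⟩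
        exact ⟨x, y, h, _, _, ⟨rfl, rfl⟩, _, _, ⟨rfl, rfl⟩, by rw [h.under]⟩
      · rintro ⟨x, y, h, _, _, ⟨rfl, rfl⟩, _, _, ⟨rfl, rfl⟩, rfl⟩
        exact ⟨_, _, ⟨rfl, rfl⟩, _, _, ⟨rfl, rfl⟩, _, _, h, by rw [h.under]⟩
    | overLR =>
      constructor
      · rintro ⟨_, _, ⟨rfl, rfl⟩, _, _, ⟨rfl, rfl⟩, x, y, h, rfl⟩
        obtain ⟨x', y', rfl, rfl, h'⟩ := h.of_signedStar
        exact ⟨x', y', h', _, _, ⟨rfl, rfl⟩, _, _,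
          ⟨rfl, rfl⟩, rfl⟩
      · rintro ⟨x, y, h, _, _, ⟨rfl, rfl⟩, _, _, ⟨rfl, rfl⟩, rfl⟩
        exact ⟨_, _, ⟨rfl, rfl⟩, _, _, ⟨rfl, rfl⟩, _, _,
          (crossingColouring_signedStar _ _).2 h, rfl⟩

theorem colourEquivalent_pass_right {k : CrossingKind} (k' : CrossingKind) (hk : k ≠ .sing)
    (d e f : Dir) :
    ColourEquivalent X 3
      [⟨[d], .cross k e f, []⟩, ⟨[], .cross k d f, [e]⟩, ⟨[f], .cross k' d e, []⟩]
      [⟨[], .cross k' d e, [f]⟩, ⟨[e], .cross k d f, []⟩, ⟨[], .cross k e f, [d]⟩] := by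
  refine ⟨boundaryDetermines_cons_classical ⟨k, e, f, hk, rfl⟩
    (boundaryDetermines_cons_classical ⟨k, d, f, hk, rfl⟩ (boundaryDetermines_singleton _ _)),
    boundaryDetermines_cons_of_classical ?_, ?_⟩
  · simpa using ⟨⟨k, d, f, hk, rfl⟩, ⟨k, e, f, hk, rfl⟩⟩
  · intro t b ht
    obtain ⟨p, q, r, rfl⟩ := List.length_eq_three.1 ht
    simp only [boundaryColouring_left_cross, boundaryColouring_cross_right, boundaryColouring_nil]
    cases k with
    | sing => exact absurd rfl hk
    | overRL =>
      constructor
      · rintro ⟨_, _, ⟨rfl, rfl⟩, _, _, ⟨rfl, rfl⟩, x, y, h, rfl⟩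
        obtain ⟨x', y', rfl, rfl, h'⟩ := h.of_signedStar
        exact ⟨x', y', h', _, _, ⟨rfl, rfl⟩, _, _,
          ⟨rfl, rfl⟩, rfl⟩
      · rintro ⟨x, y, h, _, _, ⟨rfl, rfl⟩, _, _, ⟨rfl, rfl⟩, rfl⟩
        exact ⟨_, _, ⟨rfl, rfl⟩, _, _, ⟨rfl, rfl⟩, _, _,
          (crossingColouring_signedStar _ _).2 h, rfl⟩
    | overLR =>
      -- The rule for passing under a crossing, read from right to left.
      have under : ∀ x y : X, CrossingColouring k' d e p q x y →
          signedStar (!d) (signedStar (!e) r q) p = signedStar (!e) (signedStar (!d) r y) x := by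
        intro x y h
        have h' := h.under (signedStar (!d) (signedStar (!e) r q) p)
        rw [signedStar_cancel, signedStar_cancel] at h'
        rw [← signedStar_not_cancel e (signedStar (!d) (signedStar (!e) r q) p) x,
          ← signedStar_not_cancel d (signedStar e _ x) y, ← h']
      constructor
      · rintro ⟨_, _, ⟨rfl, rfl⟩, _, _, ⟨rfl, rfl⟩, x, y, h, rfl⟩
        exact ⟨x, y, h, _, _, ⟨rfl, rfl⟩, _, _, ⟨rfl, rfl⟩, by rw [under x y h]⟩
      · rintro ⟨x, y, h, _, _, ⟨rfl, rfl⟩, _, _, ⟨rfl, rfl⟩, rfl⟩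
        exact ⟨_, _, ⟨rfl, rfl⟩, _, _, ⟨rfl, rfl⟩, _, _, h, by rw [under _ _ h]⟩

theorem colourEquivalent_reidemeister5 {k : CrossingKind} (hk : k ≠ .sing) (d e : Dir) :
    ColourEquivalent X 2 [⟨[], .cross k d e, []⟩, ⟨[], .cross .sing e d, []⟩]
      [⟨[], .cross .sing d e, []⟩, ⟨[], .cross k e d, []⟩] := by
  refine ⟨boundaryDetermines_cons_classical ⟨k, d, e, hk, rfl⟩ (boundaryDetermines_singleton _ _),
    boundaryDetermines_cons_of_classical ?_, ?_⟩
  · simpa using ⟨k, e, d, hk, rfl⟩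
  · intro t b ht
    obtain ⟨p, q, rfl⟩ := List.length_eq_two.1 ht
    simp only [boundaryColouring_cross, boundaryColouring_nil]
    constructor
    · rintro ⟨r, s, h, x, y, h', rfl⟩
      obtain ⟨r', s', h1, h2⟩ := (exists_crossing_singular_iff hk).1 ⟨r, s, h, h'⟩
      exact ⟨r', s', h1, x, y, h2, rfl⟩
    · rintro ⟨r, s, h, x, y, h', rfl⟩
      obtain ⟨r', s', h1, h2⟩ := (exists_crossing_singular_iff hk).2 ⟨r, s, h, h'⟩
      exact ⟨r', s', h1, x, y, h2, rfl⟩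

variable (X) in
/-- Each local move replaces a tangle by a colour equivalent one. The number of upper ends is read
off from the first slice of the left-hand side, which is never empty. -/
theorem LocalMove.colourEquivalent {m m' : List Slice} (h : LocalMove m m') :
    ∃ s w, m = s :: w ∧ ColourEquivalent X s.top.length m m' := by
  cases h with
  | exchange g h m =>
    have e := colourEquivalent_exchange (X := X) g h m
    rw [List.append_assoc] at e
    exact ⟨_, _, rfl, e⟩
  | zigzag_left d => exact ⟨_, _, rfl, colourEquivalent_zigzag_left d⟩
  | zigzag_right d => exact ⟨_, _, rfl, colourEquivalent_zigzag_right d⟩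
  | slide_minimum k d e => exact ⟨_, _, rfl, colourEquivalent_slide_minimum k d e⟩
  | slide_maximum k d e => exact ⟨_, _, rfl, colourEquivalent_slide_maximum k d e⟩
  | reidemeister1_maximum k hk d =>
    exact ⟨_, _, rfl, colourEquivalent_reidemeister1_maximum hk d⟩
  | reidemeister1_minimum k hk d =>
    exact ⟨_, _, rfl, colourEquivalent_reidemeister1_minimum hk d⟩
  | reidemeister2 k hk d e => exact ⟨_, _, rfl, colourEquivalent_reidemeister2 hk d e⟩
  | pass_left k k' hk d e f => exact ⟨_, _, rfl, colourEquivalent_pass_left k' hk d e f⟩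
  | pass_right k k' hk d e f => exact ⟨_, _, rfl, colourEquivalent_pass_right k' hk d e f⟩
  | reidemeister5 k hk d e => exact ⟨_, _, rfl, colourEquivalent_reidemeister5 hk d e⟩

end LocalMoves

/-! ### Vertical strands beside a tangle -/

section Padding

variable {X : Type*} {a b : List Dir} {ca cb : List X}

theorem getLastD_map_pad (ca cb t : List X) (l : List (List X)) :
    (l.map (fun c => ca ++ (c ++ cb))).getLastD (ca ++ (t ++ cb)) =
      ca ++ (l.getLastD t ++ cb) := by
  induction l generalizing t with
  | nil => rfl
  | cons c l ih => rw [List.map_cons, List.getLastD_cons, List.getLastD_cons, ih]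

theorem exists_eq_pad {N : ℕ} (t : List X) (ht : t.length = a.length + N + b.length) :
    ∃ ca t' cb : List X, t = ca ++ (t' ++ cb) ∧ ca.length = a.length ∧ t'.length = N ∧
      cb.length = b.length := by
  refine ⟨t.take a.length, (t.drop a.length).take N, (t.drop a.length).drop N, by simp, ?_, ?_, ?_⟩
    <;> simp <;> omega

variable [Singquandle X]

theorem sliceColouring_pad (ha : ca.length = a.length) (hb : cb.length = b.length) {s : Slice}
    {t e : List X} : SliceColouring (s.pad a b) (ca ++ (t ++ cb)) e ↔
      ∃ e', e = ca ++ (e' ++ cb) ∧ SliceColouring s t e' := by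
  constructor
  · rintro ⟨cl, ct, cm, cr, hl, hr, h, rfl, hp⟩
    simp only [Slice.pad, List.length_append] at hl hr
    obtain ⟨cl₁, cl₂, rfl, h₁⟩ : ∃ cl₁ cl₂, cl = cl₁ ++ cl₂ ∧ cl₁.length = a.length :=
      ⟨cl.take a.length, cl.drop a.length, by simp, by simp; omega⟩
    obtain ⟨cr₁, cr₂, rfl, h₂⟩ : ∃ cr₁ cr₂, cr = cr₁ ++ cr₂ ∧ cr₁.length = s.right.length :=
      ⟨cr.take s.right.length, cr.drop s.right.length, by simp, by simp; omega⟩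
    rw [List.append_assoc] at h
    obtain ⟨rfl, h'⟩ := List.append_inj h (ha.trans h₁.symm)
    have e : cl₂ ++ (ct ++ (cr₁ ++ cr₂)) = (cl₂ ++ (ct ++ cr₁)) ++ cr₂ := by simp
    rw [e] at h'
    simp only [List.length_append] at hl hr
    obtain ⟨rfl, rfl⟩ := List.append_inj' h' (by omega)
    exact ⟨cl₂ ++ (cm ++ cr₁), by simp, cl₂, ct, cm, cr₁, by omega, h₂, rfl, rfl, hp⟩
  · rintro ⟨_, rfl, cl, ct, cm, cr, hl, hr, rfl, rfl, hp⟩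
    exact ⟨ca ++ cl, ct, cm, cr ++ cb, by simp [Slice.pad, ha, hl], by simp [Slice.pad, hb, hr],
      by simp, by simp, hp⟩

theorem tangleColouring_pad (ha : ca.length = a.length) (hb : cb.length = b.length)
    {m : List Slice} {t : List X} {l : List (List X)} :
    TangleColouring (m.map (Slice.pad a b)) (ca ++ (t ++ cb)) l ↔
      ∃ l', l = l'.map (fun c => ca ++ (c ++ cb)) ∧ TangleColouring m t l' := by
  induction m generalizing t l with
  | nil =>
    constructor
    · rintro rfl
      exact ⟨[], rfl, rfl⟩
    · rintro ⟨_, rfl, rfl⟩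
      rfl
  | cons s m ih =>
    cases l with
    | nil =>
      refine ⟨fun h => h.elim, ?_⟩
      rintro ⟨l', hl, h⟩
      obtain rfl := List.map_eq_nil_iff.1 hl.symm
      exact h.elim
    | cons c l =>
      constructor
      · rintro ⟨h, h'⟩
        obtain ⟨c', rfl, hc⟩ := (sliceColouring_pad ha hb).1 h
        obtain ⟨l', rfl, hl⟩ := ih.1 h'
        exact ⟨c' :: l', rfl, hc, hl⟩
      · rintro ⟨l', hl, h⟩
        cases l' with
        | nil => exact h.elim
        | cons c' l' =>
          obtain ⟨rfl, rfl⟩ := List.cons_eq_cons.1 hl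
          exact ⟨(sliceColouring_pad ha hb).2 ⟨c', rfl, h.1⟩, ih.2 ⟨l', rfl, h.2⟩⟩

theorem BoundaryDetermines.pad {N : ℕ} {m : List Slice} (h : BoundaryDetermines X N m)
    (a b : List Dir) :
    BoundaryDetermines X (a.length + N + b.length) (m.map (Slice.pad a b)) := by
  intro t l l' ht hl hl' hlast
  obtain ⟨ca, t, cb, rfl, ha, hN, hb⟩ := exists_eq_pad t ht
  obtain ⟨l, rfl, h₁⟩ := (tangleColouring_pad ha hb).1 hl
  obtain ⟨l', rfl, h₂⟩ := (tangleColouring_pad ha hb).1 hl'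
  rw [getLastD_map_pad, getLastD_map_pad] at hlast
  rw [h t l l' hN h₁ h₂ (by simpa using hlast)]

theorem boundaryColouring_pad (ha : ca.length = a.length) (hb : cb.length = b.length)
    {m : List Slice} {t e : List X} :
    BoundaryColouring (m.map (Slice.pad a b)) (ca ++ (t ++ cb)) e ↔
      ∃ e', e = ca ++ (e' ++ cb) ∧ BoundaryColouring m t e' := by
  constructor
  · rintro ⟨l, h, rfl⟩
    obtain ⟨l', rfl, h'⟩ := (tangleColouring_pad ha hb).1 h
    exact ⟨_, getLastD_map_pad _ _ _ _, l', h', rfl⟩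
  · rintro ⟨_, rfl, l', h', rfl⟩
    exact ⟨_, (tangleColouring_pad ha hb).2 ⟨l', rfl, h'⟩, getLastD_map_pad _ _ _ _⟩

theorem ColourEquivalent.pad {N : ℕ} {m m' : List Slice} (h : ColourEquivalent X N m m')
    (a b : List Dir) : ColourEquivalent X (a.length + N + b.length) (m.map (Slice.pad a b))
      (m'.map (Slice.pad a b)) := by
  refine ⟨h.unique.pad a b, h.unique'.pad a b, fun t e ht => ?_⟩
  obtain ⟨ca, t, cb, rfl, ha, hN, hb⟩ := exists_eq_pad t ht
  rw [boundaryColouring_pad ha hb, boundaryColouring_pad ha hb]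
  simp only [h.boundary t _ hN]

end Padding

/-! ### Invariance under local moves -/

/-- Colours outside the part `m` of the stack `u ++ (m ++ v)`: those on the lines below the slices
of `u`, then those on the line below `m` and on the lines below the slices of `v`. -/
def outerColourings (u m v : List Slice) : ListFamily := fun _ _ o =>
  ∃ l₁ b l₂, o = l₁ ++ b :: l₂ ∧ TangleColouring u [] l₁ ∧
    BoundaryColouring m (l₁.getLastD []) b ∧ TangleColouring v b l₂

theorem IsUniversal.outer {u m v : List Slice} {N : ℕ}
    (hu : ∀ (X : Type) [Singquandle X] (l : List (List X)), TangleColouring u [] l →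
      (l.getLastD []).length = N)
    (hm : ∀ (X : Type) [Singquandle X], BoundaryDetermines X N m)
    {Q : Type} [Singquandle Q] {κ : List (List Q)}
    (h : IsUniversal (colourings (u ++ (m ++ v))) Q κ) :
    ∃ κ', IsUniversal (outerColourings u m v) Q κ' := by
  -- Delete the lines below the slices of `m` except the last one. The list `[] :: l` contains the
  -- upper boundary as well, which is that last line if `u` and `m` are empty.
  let φ : ∀ X : Type, List (List X) → List (List X) := fun X l =>
    l.take u.length ++ ([] :: l).drop (u.length + m.length)
  have value : ∀ (X : Type) [Singquandle X] (l₁ l₂ l₃ : List (List X)) (t : List X),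
      TangleColouring u [] l₁ → TangleColouring m t l₂ →
      φ X (l₁ ++ (l₂ ++ l₃)) = l₁ ++ l₂.getLastD (l₁.getLastD []) :: l₃ := by
    intro X _ l₁ l₂ l₃ t h₁ h₂
    change List.take _ _ ++ List.drop _ _ = _
    rw [← h₁.length_eq, ← h₂.length_eq, List.take_left, ← List.drop_drop,
      drop_cons_append_length, drop_cons_append_length]
  refine ⟨φ Q κ, h.transfer φ ?_ ?_ ?_ ?_ ?_⟩
  · intro X Y _ _ f c
    have e : ([] : List Y) :: f.mapLists c = f.mapLists ([] :: c) := rfl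
    change List.take _ _ ++ List.drop _ _ = _
    rw [e]
    simp [φ, SQHom.mapLists]
  · intro X Y _ _ f c hc
    exact TangleColouring.map f hc
  · intro X _ c hc
    obtain ⟨l₁, l, rfl, h₁, hl⟩ := tangleColouring_append.1 hc
    obtain ⟨l₂, l₃, rfl, h₂, h₃⟩ := tangleColouring_append.1 hl
    rw [value X l₁ l₂ l₃ _ h₁ h₂]
    exact ⟨l₁, _, l₃, rfl, h₁, ⟨l₂, h₂, rfl⟩, h₃⟩
  · intro X _ c c' hc hc' he
    obtain ⟨l₁, l, rfl, h₁, hl⟩ := tangleColouring_append.1 hc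
    obtain ⟨l₂, l₃, rfl, h₂, h₃⟩ := tangleColouring_append.1 hl
    obtain ⟨l₁', l', rfl, h₁', hl'⟩ := tangleColouring_append.1 hc'
    obtain ⟨l₂', l₃', rfl, h₂', h₃'⟩ := tangleColouring_append.1 hl'
    rw [value X l₁ l₂ l₃ _ h₁ h₂, value X l₁' l₂' l₃' _ h₁' h₂'] at he
    obtain ⟨rfl, he'⟩ := List.append_inj he (h₁.length_eq.trans h₁'.length_eq.symm)
    obtain ⟨hlast, rfl⟩ := List.cons_eq_cons.1 he'
    rw [hm X _ l₂ l₂' (hu X l₁ h₁) h₂ h₂' hlast]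
  · rintro X _ o ⟨l₁, b, l₃, rfl, h₁, ⟨l₂, h₂, rfl⟩, h₃⟩
    exact ⟨l₁ ++ (l₂ ++ l₃), tangleColouring_append.2 ⟨l₁, _, rfl, h₁,
      tangleColouring_append.2 ⟨l₂, l₃, rfl, h₂, h₃⟩⟩, value X l₁ l₂ l₃ _ h₁ h₂⟩

theorem IsUniversal.congr {P P' : ListFamily} {Q : Type} [Singquandle Q] {κ : List (List Q)}
    (h : IsUniversal P Q κ) (hP : ∀ (X : Type) [Singquandle X] (c), P X c ↔ P' X c) :
    IsUniversal P' Q κ :=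
  ⟨(hP Q κ).1 h.mem, fun X _ c hc => h.existsUnique X c ((hP X c).2 hc)⟩

theorem IsTangle.exists_of_append {α β : List Dir} {u v : List Slice}
    (h : IsTangle α (u ++ v) β) : ∃ γ, IsTangle α u γ ∧ IsTangle γ v β := by
  induction u generalizing α with
  | nil => exact ⟨α, rfl, h⟩
  | cons s u ih =>
    obtain ⟨γ, h₁, h₂⟩ := ih h.2
    exact ⟨γ, ⟨h.1, h₁⟩, h₂⟩

/-- Singquandles which represent the colourings of two diagrams that differ by a local move are
isomorphic, since the colourings of both diagrams are determined by the same outer colours. -/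
theorem LinkDiagram.Move.nonempty_equiv {D D' : LinkDiagram} (h : D.Move D')
    {Q Q' : Type} [Singquandle Q] [Singquandle Q'] {κ : List (List Q)} {κ' : List (List Q')}
    (hQ : IsUniversal (colourings D.slices) Q κ) (hQ' : IsUniversal (colourings D'.slices) Q' κ') :
    Nonempty (SQEquiv Q Q') := by
  obtain ⟨u, v, m, m', a, b, hm, hD, hD'⟩ := h
  rw [List.append_assoc] at hD hD'
  have closed := D.closed
  rw [hD] at hQ closed
  rw [hD'] at hQ'
  obtain ⟨s, w, hsw, -⟩ := hm.colourEquivalent Q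
  have equivalent : ∀ (X : Type) [Singquandle X],
      ColourEquivalent X (a.length + s.top.length + b.length) (m.map (Slice.pad a b))
        (m'.map (Slice.pad a b)) := by
    intro X _
    obtain ⟨s', w', hsw', h⟩ := hm.colourEquivalent X
    obtain ⟨rfl, -⟩ := List.cons_eq_cons.1 (hsw.symm.trans hsw')
    exact h.pad a b
  have hu : ∀ (X : Type) [Singquandle X] (l : List (List X)), TangleColouring u [] l →
      (l.getLastD []).length = a.length + s.top.length + b.length := by
    intro X _ l hl
    obtain ⟨γ, h₁, h₂⟩ := closed.exists_of_append
    rw [hsw] at h₂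
    rw [hl.length_last h₁ (t := ([] : List X)) rfl, ← h₂.1]
    simp only [Slice.pad, Slice.top, List.length_append]
    omega
  obtain ⟨_, h₁⟩ := hQ.outer hu fun X _ => (equivalent X).unique
  obtain ⟨_, h₂⟩ := hQ'.outer hu fun X _ => (equivalent X).unique'
  refine (h₁.congr fun X _ o => ?_).nonempty_equiv h₂
  constructor
  · rintro ⟨l₁, c, l₂, rfl, hl, hb, hr⟩
    exact ⟨l₁, c, l₂, rfl, hl, ((equivalent X).boundary _ _ (hu X l₁ hl)).1 hb, hr⟩
  · rintro ⟨l₁, c, l₂, rfl, hl, hb, hr⟩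
    exact ⟨l₁, c, l₂, rfl, hl, ((equivalent X).boundary _ _ (hu X l₁ hl)).2 hb, hr⟩

/-! ### Colourings of the closure of a braid -/

section Closure

variable {X : Type*}

/-- The colours below nested maxima if the left legs have the colours `x`, the outermost first. -/
def maximaColours (x : List X) : List (List X) :=
  (List.range x.length).map fun j => x.take (j + 1) ++ (x.take (j + 1)).reverse

/-- The colours below the slices of nested minima if the left legs have the colours `x`, the outermost
first. -/
def minimaColours (x : List X) : List (List X) :=
  (List.range x.length).reverse.map fun j => x.take j ++ (x.take j).reverse

theorem maximaColours_append_singleton (x : List X) (a : X) :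
    maximaColours (x ++ [a]) = maximaColours x ++ [(x ++ [a]) ++ (x ++ [a]).reverse] := by
  simp only [maximaColours, List.length_append, List.length_singleton, List.range_succ,
    List.map_append, List.map_singleton]
  congr 1
  · refine List.map_congr_left fun j hj => ?_
    rw [List.take_append_of_le_length (by simpa using hj)]
  · rw [List.take_of_length_le (by simp)]

theorem minimaColours_append_singleton (x : List X) (a : X) :
    minimaColours (x ++ [a]) = (x ++ x.reverse) :: minimaColours x := by
  simp only [minimaColours, List.length_append, List.length_singleton, List.range_succ,
    List.reverse_append, List.reverse_singleton, List.singleton_append, List.map_cons]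
  congr 1
  · simp
  · refine List.map_congr_left fun j hj => ?_
    have hj : j < x.length := by simpa using hj
    rw [List.take_append_of_le_length hj.le]

theorem length_maximaColours (x : List X) : (maximaColours x).length = x.length := by
  simp [maximaColours]

theorem getLastD_maximaColours (x : List X) :
    (maximaColours x).getLastD [] = x ++ x.reverse := by
  induction x using List.reverseRecOn with
  | nil => rfl
  | append_singleton x a _ => rw [maximaColours_append_singleton, List.getLastD_concat]

theorem exists_eq_append_singleton {x : List X} {n : ℕ} (hx : x.length = n + 1) :
    ∃ y a, x = y ++ [a] ∧ y.length = n := by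
  induction x using List.reverseRecOn with
  | nil => simp at hx
  | append_singleton y a _ => exact ⟨y, a, rfl, by simpa using hx⟩

/-- The slice form of `replacePair`: `i` entries, the two new ones, and the remaining entries. -/
theorem ofFn_replacePair {n i : ℕ} (h : i + 1 < n) (a b : X) (x : Fin n → X) :
    List.ofFn (replacePair i a b x) =
      (List.ofFn x).take i ++ ([a, b] ++ (List.ofFn x).drop (i + 2)) := by
  refine List.ext_getElem (by simp; omega) fun j h₁ h₂ => ?_
  simp only [List.length_ofFn] at h₁
  rw [List.getElem_ofFn]
  simp only [replacePair]
  rcases lt_trichotomy j i with hj | rfl | hj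
  · rw [if_neg (by omega), if_neg (by omega), List.getElem_append_left (by simp; omega)]
    simp
  · rw [if_pos rfl, List.getElem_append_right (by simp)]
    simp [Nat.min_eq_left (by omega : j ≤ n)]
  · rw [if_neg (by omega), List.getElem_append_right (by simp; omega)]
    obtain ⟨m, rfl⟩ : ∃ m, j = i + 1 + m := ⟨j - (i + 1), by omega⟩
    simp only [List.length_take, List.length_ofFn, Nat.min_eq_left (by omega : i ≤ n)]
    cases m with
    | zero => simp
    | succ m =>
      rw [if_neg (by omega)]
      have e : i + 1 + (m + 1) - i = m + 2 := by omega
      simp only [e]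
      simp [add_comm, add_left_comm]

variable [Singquandle X]

theorem tangleColouring_singleton {s : Slice} {t : List X} {l : List (List X)} :
    TangleColouring [s] t l ↔ ∃ c, l = [c] ∧ SliceColouring s t c := by
  rcases l with _ | ⟨c, _ | ⟨c', l⟩⟩ <;> simp [TangleColouring]

theorem tangleColouring_nestedMaxima {n : ℕ} {l : List (List X)} :
    TangleColouring (nestedMaxima n) [] l ↔ ∃ x : List X, x.length = n ∧ l = maximaColours x := by
  induction n generalizing l with
  | zero =>
    constructor
    · rintro rfl
      exact ⟨[], rfl, rfl⟩
    · rintro ⟨x, hx, rfl⟩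
      obtain rfl := List.length_eq_zero_iff.1 hx
      rfl
  | succ n ih =>
    have e : nestedMaxima (n + 1) = nestedMaxima n ++
        [⟨.replicate n true, .maximum true, .replicate n false⟩] := by
      simp [nestedMaxima, List.range_succ]
    have step : ∀ (x c : List X), x.length = n →
        (SliceColouring ⟨.replicate n true, .maximum true, .replicate n false⟩
          ((maximaColours x).getLastD []) c ↔ ∃ a, c = (x ++ [a]) ++ (x ++ [a]).reverse) := by
      intro x c hx
      have hl : x.length = (List.replicate n true).length := by simp [hx]
      have hr : x.reverse.length = (List.replicate n false).length := by simp [hx]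
      rw [getLastD_maximaColours, ← List.nil_append x.reverse,
        sliceColouring_iff (ct := ([] : List X)) hl rfl hr]
      constructor
      · rintro ⟨_, rfl, -, a, rfl⟩
        exact ⟨a, by simp⟩
      · rintro ⟨a, rfl⟩
        exact ⟨[a, a], by simp, rfl, a, rfl⟩
    rw [e, tangleColouring_append]
    constructor
    · rintro ⟨_, l₂, rfl, h₁, h₂⟩
      obtain ⟨x, hx, rfl⟩ := ih.1 h₁
      obtain ⟨c, rfl, hc⟩ := tangleColouring_singleton.1 h₂
      obtain ⟨a, rfl⟩ := (step x c hx).1 hc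
      exact ⟨x ++ [a], by simp [hx], (maximaColours_append_singleton x a).symm⟩
    · rintro ⟨_, hx, rfl⟩
      obtain ⟨x, a, rfl, hn⟩ := exists_eq_append_singleton hx
      exact ⟨_, _, maximaColours_append_singleton x a, ih.2 ⟨x, hn, rfl⟩,
        tangleColouring_singleton.2 ⟨_, rfl, (step x _ hn).2 ⟨a, rfl⟩⟩⟩

theorem tangleColouring_nestedMinima {n : ℕ} {x y : List X} (hx : x.length = n)
    (hy : y.length = n) {l : List (List X)} :
    TangleColouring (nestedMinima n) (x ++ y) l ↔ y = x.reverse ∧ l = minimaColours x := by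
  induction n generalizing x y l with
  | zero =>
    obtain rfl := List.length_eq_zero_iff.1 hx
    obtain rfl := List.length_eq_zero_iff.1 hy
    simp [nestedMinima, TangleColouring, minimaColours]
  | succ n ih =>
    obtain ⟨x, a, rfl, hn⟩ := exists_eq_append_singleton hx
    obtain ⟨b, y, rfl⟩ := List.exists_cons_of_length_eq_add_one hy
    replace hy : y.length = n := by simpa using hy
    have e : nestedMinima (n + 1) =
        ⟨.replicate n true, .minimum true, .replicate n false⟩ :: nestedMinima n := by
      simp [nestedMinima, List.range_succ]
    have e' : x ++ [a] ++ b :: y = x ++ ([a, b] ++ y) := by simp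
    rw [e, e', minimaColours_append_singleton]
    cases l with
    | nil => simp [TangleColouring]
    | cons c l =>
      simp only [TangleColouring]
      have hl : x.length = (List.replicate n true).length := by simp [hn]
      have hr : y.length = (List.replicate n false).length := by simp [hy]
      rw [sliceColouring_iff (ct := [a, b]) hl rfl hr]
      constructor
      · rintro ⟨⟨_, rfl, ⟨z, ⟨⟩⟩, rfl⟩, h⟩
        rw [List.nil_append, ih hn hy] at h
        obtain ⟨rfl, rfl⟩ := h
        exact ⟨by simp, rfl⟩
      · rintro ⟨h, hl⟩
        obtain ⟨rfl, rfl⟩ : b = a ∧ y = x.reverse := by simpa using h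
        obtain ⟨rfl, rfl⟩ := List.cons_eq_cons.1 hl
        exact ⟨⟨[], rfl, ⟨b, rfl⟩, rfl⟩, (ih hn hy).2 ⟨rfl, rfl⟩⟩

/-- A crossing of the strands `i` and `i + 1` whose lower colours `a`, `b` are determined by the upper
ones replaces the corresponding two entries of the tuple of colours. -/
theorem sliceColouring_cross_iff {n i : ℕ} (h : i + 1 < n) {k : CrossingKind} (x : Fin n → X)
    {y : List X} (hy : y.length = n) {a b : X}
    (hk : ∀ r s, CrossingColouring k true true (x ⟨i, by omega⟩) (x ⟨i + 1, h⟩) r s ↔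
      r = a ∧ s = b) {c : List X} :
    SliceColouring ⟨.replicate i true, .cross k true true,
        .replicate (n - (i + 2)) true ++ .replicate n false⟩ (List.ofFn x ++ y) c ↔
      c = List.ofFn (replacePair i a b x) ++ y := by
  have e : List.ofFn x ++ y = (List.ofFn x).take i ++
      ([x ⟨i, by omega⟩, x ⟨i + 1, h⟩] ++ ((List.ofFn x).drop (i + 2) ++ y)) := by
    have hx : replacePair i (x ⟨i, by omega⟩) (x ⟨i + 1, h⟩) x = x := by
      funext j
      simp only [replacePair]
      split_ifs with h₁ h₂
      · exact congrArg x (Fin.ext h₁.symm)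
      · exact congrArg x (Fin.ext h₂.symm)
      · rfl
    conv_lhs => rw [← hx, ofFn_replacePair h]
    simp
  have hl : ((List.ofFn x).take i).length = (List.replicate i true).length := by simp; omega
  have hr : ((List.ofFn x).drop (i + 2) ++ y).length =
      (List.replicate (n - (i + 2)) true ++ List.replicate n false).length := by simp [hy]
  rw [e, sliceColouring_iff (ct := [x ⟨i, by omega⟩, x ⟨i + 1, h⟩]) hl rfl hr,
    ofFn_replacePair h]
  constructor
  · rintro ⟨_, rfl, _, _, r, s, ⟨⟩, rfl, hc⟩
    obtain ⟨rfl, rfl⟩ := (hk r s).1 hc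
    simp
  · rintro rfl
    exact ⟨[a, b], by simp, _, _, a, b, rfl, rfl, (hk a b).2 ⟨rfl, rfl⟩⟩

/-- The representation by endomorphisms of free singquandles describes how the colours of `n`
strands running downward change along a braid. -/
theorem sliceColouring_slice {n : ℕ} (g : SBGen n) (x : Fin n → X) {y : List X}
    (hy : y.length = n) {c : List X} : SliceColouring g.slice (List.ofFn x ++ y) c ↔
      c = List.ofFn (phiGenTuple x g) ++ y := by
  cases g with
  | sigma i h => exact sliceColouring_cross_iff h x hy fun r s => Iff.rfl
  | sigmaInv i h => exact sliceColouring_cross_iff h x hy fun r s => Iff.rfl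
  | tau i h => exact sliceColouring_cross_iff h x hy fun r s => Iff.rfl

/-- The colours below the slices of a braid word, with the colours `x` on the braid strands above it
and the colours `y` on the closing strands. -/
def braidColours {n : ℕ} (y : List X) : List (SBGen n) → (Fin n → X) → List (List X)
  | [], _ => []
  | g :: w, x => (List.ofFn (phiGenTuple x g) ++ y) :: braidColours y w (phiGenTuple x g)

theorem tangleColouring_braid {n : ℕ} (w : List (SBGen n)) (x : Fin n → X) {y : List X}
    (hy : y.length = n) {l : List (List X)} :
    TangleColouring (w.map SBGen.slice) (List.ofFn x ++ y) l ↔ l = braidColours y w x := by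
  induction w generalizing x l with
  | nil => rfl
  | cons g w ih =>
    cases l with
    | nil => simp [TangleColouring, braidColours]
    | cons c l =>
      simp only [List.map_cons, TangleColouring, braidColours, List.cons.injEq]
      rw [sliceColouring_slice g x hy]
      refine and_congr_right ?_
      rintro rfl
      exact ih _

theorem getLastD_braidColours {n : ℕ} (w : List (SBGen n)) (x : Fin n → X) (y : List X) :
    (braidColours y w x).getLastD (List.ofFn x ++ y) =
      List.ofFn (w.foldl phiGenTuple x) ++ y := by
  induction w generalizing x with
  | nil => rfl
  | cons g w ih => rw [braidColours, List.getLastD_cons, ih, List.foldl_cons]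

/-- A colouring of the closure of a braid is given by colours of the braid strands at the top which
reappear at the bottom. -/
theorem tangleColouring_closureDiagram {n : ℕ} (w : FreeMonoid (SBGen n)) {l : List (List X)} :
    TangleColouring (closureDiagram w).slices [] l ↔ ∃ x : Fin n → X,
      w.toList.foldl phiGenTuple x = x ∧ l = maximaColours (List.ofFn x) ++
        (braidColours (List.ofFn x).reverse w.toList x ++ minimaColours (List.ofFn x)) := by
  change TangleColouring (nestedMaxima n ++ (w.toList.map SBGen.slice ++ nestedMinima n)) [] l ↔ _
  rw [tangleColouring_append]
  have minima : ∀ (x : Fin n → X) (l : List (List X)),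
      TangleColouring (nestedMinima n) (List.ofFn (w.toList.foldl phiGenTuple x) ++
        (List.ofFn x).reverse) l ↔
      w.toList.foldl phiGenTuple x = x ∧ l = minimaColours (List.ofFn x) := by
    intro x l
    rw [tangleColouring_nestedMinima (by simp) (by simp), List.reverse_inj,
      List.ofFn_injective.eq_iff, eq_comm]
    refine and_congr_right fun h => ?_
    rw [h]
  constructor
  · rintro ⟨_, _, rfl, h₁, h⟩
    obtain ⟨x, hx, rfl⟩ := tangleColouring_nestedMaxima.1 h₁
    obtain ⟨x, rfl⟩ : ∃ x' : Fin n → X, x = List.ofFn x' := by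
      subst hx
      exact ⟨x.get, (List.ofFn_get x).symm⟩
    obtain ⟨_, l₃, rfl, h₂, h₃⟩ := tangleColouring_append.1 h
    rw [getLastD_maximaColours] at h₂ h₃
    obtain rfl := (tangleColouring_braid w.toList x (by simp)).1 h₂
    rw [getLastD_braidColours] at h₃
    obtain ⟨hx, rfl⟩ := (minima x l₃).1 h₃
    exact ⟨x, hx, rfl⟩
  · rintro ⟨x, hx, rfl⟩
    refine ⟨_, _, rfl, tangleColouring_nestedMaxima.2 ⟨_, by simp, rfl⟩,
      tangleColouring_append.2 ⟨_, _, rfl, ?_, ?_⟩⟩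
    · rw [getLastD_maximaColours]
      exact (tangleColouring_braid w.toList x (by simp)).2 rfl
    · rw [getLastD_maximaColours, getLastD_braidColours]
      exact (minima x _).2 ⟨hx, rfl⟩

end Closure

/-- The tuples which are fixed by the action of the braid word `w`. -/
def fixedTuples {n : ℕ} (w : FreeMonoid (SBGen n)) : ListFamily := fun X _ o =>
  ∃ x : Fin n → X, w.toList.foldl phiGenTuple x = x ∧ o = [List.ofFn x]

theorem IsUniversal.fixedTuples {n : ℕ} {w : FreeMonoid (SBGen n)} {Q : Type} [Singquandle Q]
    {κ : List (List Q)} (h : IsUniversal (colourings (closureDiagram w).slices) Q κ) :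
    ∃ κ', IsUniversal (fixedTuples w) Q κ' := by
  -- The left half of the line between the maxima and the braid.
  let φ : ∀ X : Type, List (List X) → List (List X) := fun X l =>
    ((([] :: l).drop n).take 1).map (List.take n)
  have value : ∀ (X : Type) (x : Fin n → X) (l : List (List X)),
      φ X (maximaColours (List.ofFn x) ++ l) = [List.ofFn x] := by
    intro X x l
    have hn : (maximaColours (List.ofFn x)).length = n := by simp [length_maximaColours]
    have e := drop_cons_append_length [] (maximaColours (List.ofFn x)) l
    rw [hn, getLastD_maximaColours] at e
    simp only [φ, e, List.take_succ_cons, List.take_zero, List.map_singleton]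
    rw [List.take_left' (by simp)]
  refine ⟨φ Q κ, h.transfer φ ?_ ?_ ?_ ?_ ?_⟩
  · intro X Y _ _ f c
    have e : ([] : List Y) :: f.mapLists c = f.mapLists ([] :: c) := rfl
    change List.map _ (List.take _ (List.drop _ _)) = _
    rw [e]
    simp [φ, SQHom.mapLists, Function.comp_def]
  · intro X Y _ _ f c hc
    exact TangleColouring.map f hc
  · intro X _ c hc
    obtain ⟨x, hx, rfl⟩ := (tangleColouring_closureDiagram w).1 hc
    exact ⟨x, hx, value X x _⟩
  · intro X _ c c' hc hc' he
    obtain ⟨x, hx, rfl⟩ := (tangleColouring_closureDiagram w).1 hc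
    obtain ⟨x', hx', rfl⟩ := (tangleColouring_closureDiagram w).1 hc'
    rw [value, value, List.singleton_inj, List.ofFn_injective.eq_iff] at he
    rw [he]
  · rintro X _ o ⟨x, hx, rfl⟩
    exact ⟨_, (tangleColouring_closureDiagram w).2 ⟨x, hx, rfl⟩, value X x _⟩

theorem SQHom.map_foldl_phiGenTuple {X Y : Type*} [Singquandle X] [Singquandle Y] {n : ℕ}
    (f : SQHom X Y) (w : List (SBGen n)) (x : Fin n → X) (j : Fin n) :
    f.toFun (w.foldl phiGenTuple x j) = w.foldl phiGenTuple (fun k => f.toFun (x k)) j := by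
  induction w generalizing x with
  | nil => rfl
  | cons g w ih =>
    rw [List.foldl_cons, List.foldl_cons, ih]
    have e : (fun k => f.toFun (phiGenTuple x g k)) = phiGenTuple (fun k => f.toFun (x k)) g :=
      funext (f.map_phiGenTuple x g)
    rw [e]

theorem Phi_mk_toFun_of {n : ℕ} (w : FreeMonoid (SBGen n)) (j : Fin n) :
    (Phi n (PresentedMonoid.mk (SBRel n) w)).toFun (FreeSQ.of j) =
      w.toList.foldl phiGenTuple FreeSQ.of j := by
  have h := congrFun (foldl_phiGenTuple 1 w) j
  rw [one_mul] at h
  exact h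

theorem isUniversal_SQPhi {n : ℕ} (w : FreeMonoid (SBGen n)) :
    IsUniversal (fixedTuples w) (SQPhi (PresentedMonoid.mk (SBRel n) w))
      [List.ofFn fun j => (PresentedSQ.mkHom _).toFun (FreeSQ.of j)] where
  mem := by
    refine ⟨_, ?_, rfl⟩
    funext j
    rw [← SQHom.map_foldl_phiGenTuple, ← Phi_mk_toFun_of]
    exact (PresentedSQ.mkHom_eq ⟨j, rfl, rfl⟩).symm
  existsUnique X _ c hc := by
    obtain ⟨x, hx, rfl⟩ := hc
    have key : ∀ f : SQHom (SQPhi (PresentedMonoid.mk (SBRel n) w)) X,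
        f.mapLists [List.ofFn fun j => (PresentedSQ.mkHom _).toFun (FreeSQ.of j)] =
          [List.ofFn x] ↔ ∀ j, f.toFun ((PresentedSQ.mkHom _).toFun (FreeSQ.of j)) = x j := by
      intro f
      simp only [SQHom.mapLists, List.map_singleton, List.map_ofFn, List.singleton_inj,
        List.ofFn_injective.eq_iff, funext_iff, Function.comp_apply]
    simp only [key]
    refine ⟨PresentedSQ.lift (FreeSQ.lift x) ?_, fun j => rfl, fun g hg =>
      PresentedSQ.hom_ext hg⟩
    rintro _ _ ⟨j, rfl, rfl⟩
    rw [Phi_mk_toFun_of, SQHom.map_foldl_phiGenTuple]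
    exact (congrFun hx j).symm

namespace SQEquiv

variable {X Y Z : Type*} [Singquandle X] [Singquandle Y] [Singquandle Z]

theorem nonempty_refl : Nonempty (SQEquiv X X) :=
  ⟨⟨Equiv.refl X, fun _ _ => rfl, fun _ _ => rfl, fun _ _ => rfl⟩⟩

theorem nonempty_symm (h : Nonempty (SQEquiv X Y)) : Nonempty (SQEquiv Y X) := by
  obtain ⟨f⟩ := h
  refine ⟨⟨f.toEquiv.symm, fun x y => ?_, fun x y => ?_, fun x y => ?_⟩⟩ <;>
    refine f.toEquiv.symm_apply_eq.2 ?_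
  · exact ((f.map_star _ _).trans (congrArg₂ (fun x y => x ⋆ y) (f.toEquiv.apply_symm_apply x)
      (f.toEquiv.apply_symm_apply y))).symm
  · exact ((f.map_opl _ _).trans (congrArg₂ Singquandle.opl (f.toEquiv.apply_symm_apply x)
      (f.toEquiv.apply_symm_apply y))).symm
  · exact ((f.map_opr _ _).trans (congrArg₂ Singquandle.opr (f.toEquiv.apply_symm_apply x)
      (f.toEquiv.apply_symm_apply y))).symm

theorem nonempty_trans (h : Nonempty (SQEquiv X Y)) (h' : Nonempty (SQEquiv Y Z)) :
    Nonempty (SQEquiv X Z) := by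
  obtain ⟨f⟩ := h
  obtain ⟨g⟩ := h'
  exact ⟨⟨f.toEquiv.trans g.toEquiv,
    fun x y => (congrArg g.toFun (f.map_star x y)).trans (g.map_star _ _),
    fun x y => (congrArg g.toFun (f.map_opl x y)).trans (g.map_opl _ _),
    fun x y => (congrArg g.toFun (f.map_opr x y)).trans (g.map_opr _ _)⟩⟩

end SQEquiv

/-- The fundamental singquandle is an invariant of oriented singular links. -/
theorem LinkDiagram.nonempty_equiv_of_toLink_eq {D D' : LinkDiagram} (h : D.toLink = D'.toLink) :
    Nonempty (SQEquiv D.SQ D'.SQ) := by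
  replace h := Quot.eqvGen_exact h
  induction h with
  | rel D D' h => exact LinkDiagram.Move.nonempty_equiv h D.isUniversal_SQ D'.isUniversal_SQ
  | refl D => exact SQEquiv.nonempty_refl
  | symm D D' _ ih => exact SQEquiv.nonempty_symm ih
  | trans D D' D'' _ _ ih ih' => exact SQEquiv.nonempty_trans ih ih'

theorem mainTheorem5 (n : ℕ) (β : SingularBraidMonoid n) (L : SingularLink)
    (hL : IsClosure β L) (D : LinkDiagram) (hD : D.toLink = L) :
    Nonempty (SQEquiv D.SQ (SQPhi β)) := by
  obtain ⟨w, rfl, rfl⟩ := hL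
  obtain ⟨κ, hκ⟩ := (closureDiagram w).isUniversal_SQ.fixedTuples
  exact SQEquiv.nonempty_trans (LinkDiagram.nonempty_equiv_of_toLink_eq hD)
    (hκ.nonempty_equiv (isUniversal_SQPhi w))
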